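/- Consider the problem of minimizing $f(x)$ subject to $a_i(x)\ge 0$, $i=1,\dots,m$ ($m\ge 1$), where $f:\mathbf R^n\to\mathbf R$ is convex and each $a_i:\mathbf R^n\to\mathbf R$ is continuous and concave. Let $\mathcal X=\{x: a_i(x)>0\ \forall i\}$, $f^*=\inf_{\mathcal X} f$, $\mathcal L(x,y)=f(x)-\sum_i y_ia_i(x)$, $\psi_\mu(x)=f(x)-\mu\sum_i\log a_i(x)$ and $\psi_\mu^*=\inf_{\mathcal X}\psi_\mu$. Let $L_1,L_2,R>0$, $\zeta>1$. Assume that $f$ and all $a_i$ have $L_1$-Lipschitz first and $L_2$-Lipschitz second derivatives on $\mathcal X$, in the sense that for $w\in\{f,a_1,\dots,a_m\}$, $p\in\{1,2\}$, $x\in\mathcal X$ and $\|v\|_2\le 1$ the function $g(\theta)=w(x+\theta v)$ is $p+1$ times differentiable with $|g^{(p+1)}(\theta)|\le L_p$ at every $\theta$ with $x+\theta v\in\mathcal X$. Assume that $\mathcal X$ has diameter at most $R$, and let $x^{(0)}\in\mathcal X$, $\epsilon>0$. Put $$\tau_l=\frac{m}{R\zeta^{1/2}},\quad \tau_c(\mu)=\Big(\frac{\tau_l^2\mu}{L_1}\Big)^{1/3},\quad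 \mu^{(0)}=\min\Big\{\frac{L_1R^2\zeta}{m^2},\frac{L_1^4m}{RL_2^3\sqrt\zeta}\Big\},\quad \mu^{(j)}=\mu^{(0)}/2^j .$$ Call $(x,y)$ a $(\mu,\tau_l,\tau_c)$-approximate first-order Fritz John point if $a(x)>0$, $y>0$, $|y_ia_i(x)-\mu|\le\tau_c\mu/2$ for all $i$, and $\|\nabla_x\mathcal L(x,y)\|_2\le\tau_l\mu\sqrt{\|y\|_1+1}$. Assume that $\|y\|_1+1\le\zeta$ for every $(\mu^{(j)},\tau_l,\tau_c(\mu^{(j)}))$-approximate first-order Fritz John point $(x,y)$, $j=0,1,2,\dots$. *Trust-IPM* with barrier parameter $\mu$ and parameters $$\eta_s=\tfrac1{20}\Big(\frac{\tau_l^2\mu}{L_1}\Big)^{1/3},\qquad \eta_x=\tfrac1{20}\Big(\frac{\tau_l^2\mu}{L_1}\Big)^{1/6},$$ at a current point $x$ (initially its starting point), sets $S=\mathrm{diag}(a(x))$, $y=\mu S^{-1}\mathbf 1$, $r=\eta_x\sqrt{\mu/(L_1(1+\|y\|_1))}$, solves the trust-region subproblem $d_x\in\arg\min_{\|u\|_2\le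 r}\ \tfrac12u^T\nabla^2\psi_\mu(x)u+\nabla\psi_\mu(x)^Tu$ (any minimizer), and sets $d_s=\nabla a(x)d_x$, $d_y=-\mu S^{-2}d_s$, $\alpha=\min\{\eta_s/\|S^{-1}d_s\|_2,1\}$ ($\alpha=1$ if $d_s=0$), $x^+=x+\alpha d_x$, $y^+=y+\alpha d_y$. It returns $(x^+,y^+)$ if this is a $(\mu,\tau_l,\tau_c(\mu))$-approximate first-order Fritz John point with $\nabla^2\psi_\mu(x^+)\succeq-\sqrt{\tau_l}(1+\|y^+\|_1)I$; otherwise it replaces $x$ by $x^+$ and repeats. *Annealed-IPM*, for $j=0,1,2,\dots$, obtains $(x^{(j+1)},y^{(j+1)})$ by Trust-IPM with barrier parameter $\mu^{(j)}$ started at $x^{(j)}$, and returns $x^{(j+1)}$ as soon as $2\mu^{(j)}m\le\epsilon$. Then, whichever minimizers of the subproblems are used, Annealed-IPM returns a point $x\in\mathcal X$ with $f(x)-f^*\le\epsilon$ after solving at most $$\mathcal O\left(\left(m^{1/3}\Big(\frac{L_1R^2\zeta}{\epsilon}\Big)^{2/3}+1\right)\log^+\Big(\frac{m\mu^{(0)}}{\epsilon}\Big)+\frac{\psi_{\mu^{(0)}}(x^{(0)})-\psi^*_{\mu^{(0)}}}{\mu^{(0)}}\Big(\frac{L_1R^2\zeta}{m^2\mu^{(0)}}\Big)^{2/3}\right)$$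 trust-region subproblems, where $\log^+(t)=\max\{\log t,1\}$ and the constant in $\mathcal O$ is absolute. -/

import Mathlib

namespace IPM

noncomputable section

/-- Euclidean space `ℝⁿ` with the norm `‖·‖₂`. -/
abbrev E (n : ℕ) : Type := EuclideanSpace ℝ (Fin n)

/-! ### Functions with Lipschitz derivatives -/

/-- A univariate `g` has `L`-Lipschitz `p`-th derivatives on `T`: at every point of `T` it is
`p + 1` times differentiable, and its `(p + 1)`-st derivative is bounded by `L` there. -/
def LipschitzDerivReal (p : ℕ) (L : ℝ) (g : ℝ → ℝ) (T : Set ℝ) : Prop :=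
  ∀ θ ∈ T, (∀ q ≤ p, DifferentiableAt ℝ (iteratedDeriv q g) θ) ∧
    |iteratedDeriv (p + 1) g θ| ≤ L

/-- A multivariate `w` has `L`-Lipschitz `p`-th derivatives on `S`: for all `x ∈ S` and all `v`
in the unit ball, the restriction `θ ↦ w (x + θ v)` has them on `{θ | x + θ v ∈ S}`. -/
def LipschitzDeriv {n : ℕ} (p : ℕ) (L : ℝ) (w : E n → ℝ) (S : Set (E n)) : Prop :=
  ∀ x ∈ S, ∀ v : E n, ‖v‖ ≤ 1 →
    LipschitzDerivReal p L (fun θ : ℝ => w (x + θ • v)) {θ : ℝ | x + θ • v ∈ S}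

/-! ### The problem: minimize `f x` subject to `a i x ≥ 0`, `i = 1, …, m` -/

/-- The strictly feasible set `𝒳 = {x | a(x) > 0}`. -/
def feasible {n m : ℕ} (a : Fin m → E n → ℝ) : Set (E n) := {x | ∀ i, 0 < a i x}

/-- `f* = inf_{z ∈ 𝒳} f z`. -/
def optValue {n m : ℕ} (f : E n → ℝ) (a : Fin m → E n → ℝ) : ℝ := sInf (f '' feasible a)

/-- The log barrier `ψ_μ(x) = f(x) - μ ∑ log (a_i(x))`. -/
def barrier {n m : ℕ} (f : E n → ℝ) (a : Fin m → E n → ℝ) (μ : ℝ) (x : E n) : ℝ :=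
  f x - μ * ∑ i, Real.log (a i x)

/-- `ψ_μ* = inf_{z ∈ 𝒳} ψ_μ(z)`. -/
def barrierInf {n m : ℕ} (f : E n → ℝ) (a : Fin m → E n → ℝ) (μ : ℝ) : ℝ :=
  sInf (barrier f a μ '' feasible a)

/-- The Lagrangian `ℒ(x, y) = f(x) - yᵀ a(x)`. -/
def lagrangian {n m : ℕ} (f : E n → ℝ) (a : Fin m → E n → ℝ) (x : E n) (y : Fin m → ℝ) : ℝ :=
  f x - ∑ i, y i * a i x

/-- `‖y‖₁`. -/
def l1 {m : ℕ} (y : Fin m → ℝ) : ℝ := ∑ i, |y i|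

/-- The quadratic form `uᵀ ∇²g(x) u`. -/
def hessForm {n : ℕ} (g : E n → ℝ) (x u : E n) : ℝ := fderiv ℝ (fderiv ℝ g) x u u

/-- `(μ, τ_l, τ_c)`-approximate first-order Fritz John point. -/
structure FJ1 {n m : ℕ} (f : E n → ℝ) (a : Fin m → E n → ℝ) (μ τl τc : ℝ)
    (x : E n) (y : Fin m → ℝ) : Prop where
  primal_pos : ∀ i, 0 < a i x
  dual_pos : ∀ i, 0 < y i
  compl : ∀ i, |y i * a i x - μ| ≤ τc * μ / 2
  grad_lag : ‖gradient (fun z => lagrangian f a z y) x‖ ≤ τl * μ * Real.sqrt (l1 y + 1)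

/-- The additional second-order condition `∇²ψ_μ(x) ⪰ -√τ_l (1 + ‖y‖₁) I`. -/
def FJ2 {n m : ℕ} (f : E n → ℝ) (a : Fin m → E n → ℝ) (μ τl : ℝ)
    (x : E n) (y : Fin m → ℝ) : Prop :=
  ∀ u : E n, -(Real.sqrt τl * (1 + l1 y)) * ‖u‖ ^ 2 ≤ hessForm (barrier f a μ) x u

/-! ### Trust region subproblems -/

/-- The second-order model `½ uᵀ ∇²ψ_μ(x) u + ∇ψ_μ(x)ᵀ u`. -/
def model {n m : ℕ} (f : E n → ℝ) (a : Fin m → E n → ℝ) (μ : ℝ) (x u : E n) : ℝ :=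
  1 / 2 * hessForm (barrier f a μ) x u + fderiv ℝ (barrier f a μ) x u

/-- `d` is a solution of the trust region subproblem at `x` with radius `r`:
`d ∈ argmin_{‖u‖ ≤ r} model u`. -/
def IsTrustRegionSolution {n m : ℕ} (f : E n → ℝ) (a : Fin m → E n → ℝ)
    (μ : ℝ) (x : E n) (r : ℝ) (d : E n) : Prop :=
  ‖d‖ ≤ r ∧ ∀ u : E n, ‖u‖ ≤ r → model f a μ x d ≤ model f a μ x u

/-- A rule that answers trust region subproblems. Minimizers need not be unique, and the
algorithm may use any of them; the first two arguments (outer and inner iteration number) let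
the rule answer the same subproblem differently at different times, so every execution of the
algorithm is the execution for some rule. -/
abbrev Solver (n : ℕ) : Type := ℕ → ℕ → ℝ → E n → ℝ → E n

/-- All answers of the rule at strictly feasible points are minimizers. -/
def IsSolver {n m : ℕ} (f : E n → ℝ) (a : Fin m → E n → ℝ) (sol : Solver n) : Prop :=
  ∀ (j k : ℕ) (μ : ℝ) (x : E n) (r : ℝ), 0 < μ → x ∈ feasible a → 0 ≤ r →
    IsTrustRegionSolution f a μ x r (sol j k μ x r)

/-! ### Trust-IPM -/

/-- Parameters of Trust-IPM. -/
structure Params where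
  /-- barrier parameter -/
  μ : ℝ
  /-- Lagrangian gradient tolerance -/
  τl : ℝ
  /-- complementarity tolerance -/
  τc : ℝ
  /-- Lipschitz constant of the first derivatives -/
  L1 : ℝ
  /-- step size parameter -/
  ηs : ℝ
  /-- trust region radius parameter -/
  ηx : ℝ

/-- The primal choice of dual variables, `y = μ S⁻¹ 1` with `S = diag (a x)`. -/
def primalDual {n m : ℕ} (a : Fin m → E n → ℝ) (μ : ℝ) (x : E n) : Fin m → ℝ :=
  fun i => μ / a i x

/-- `r = η_x √(μ / (L₁ (1 + ‖y‖₁)))`. -/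
def radius {n m : ℕ} (a : Fin m → E n → ℝ) (p : Params) (x : E n) : ℝ :=
  p.ηx * Real.sqrt (p.μ / (p.L1 * (1 + l1 (primalDual a p.μ x))))

/-- `d_s = ∇a(x) d_x`. -/
def slackDir {n m : ℕ} (a : Fin m → E n → ℝ) (x d : E n) : Fin m → ℝ :=
  fun i => fderiv ℝ (a i) x d

/-- `‖S⁻¹ d_s‖₂`. -/
def relSlackNorm {n m : ℕ} (a : Fin m → E n → ℝ) (x d : E n) : ℝ :=
  Real.sqrt (∑ i, (slackDir a x d i / a i x) ^ 2)

/-- The step size `α = min {η_s / ‖S⁻¹ d_s‖₂, 1}`, which is `1` if `d_s = 0`. -/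
def stepSize {n m : ℕ} (a : Fin m → E n → ℝ) (ηs : ℝ) (x d : E n) : ℝ :=
  if relSlackNorm a x d = 0 then 1 else min (ηs / relSlackNorm a x d) 1

/-- `x⁺ = x + α d_x`. -/
def nextPrimal {n m : ℕ} (a : Fin m → E n → ℝ) (p : Params) (x d : E n) : E n :=
  x + stepSize a p.ηs x d • d

/-- `y⁺ = y + α d_y` with `d_y = -μ S⁻² d_s`. -/
def nextDual {n m : ℕ} (a : Fin m → E n → ℝ) (p : Params) (x d : E n) : Fin m → ℝ :=
  fun i => primalDual a p.μ x i + stepSize a p.ηs x d * (-p.μ * slackDir a x d i / a i x ^ 2)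

/-- The primal iterates of Trust-IPM started at `x0` (as long as it has not terminated), where
`sol k x r` is the direction used in iteration `k`. -/
def trustIterate {n m : ℕ} (a : Fin m → E n → ℝ) (p : Params) (sol : ℕ → E n → ℝ → E n)
    (x0 : E n) : ℕ → E n
  | 0 => x0
  | k + 1 =>
    nextPrimal a p (trustIterate a p sol x0 k)
      (sol k (trustIterate a p sol x0 k) (radius a p (trustIterate a p sol x0 k)))

/-- The direction `d_x` of iteration `k` of Trust-IPM. -/
def trustDir {n m : ℕ} (a : Fin m → E n → ℝ) (p : Params) (sol : ℕ → E n → ℝ → E n)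
    (x0 : E n) (k : ℕ) : E n :=
  sol k (trustIterate a p sol x0 k) (radius a p (trustIterate a p sol x0 k))

/-- The point `x⁺` of iteration `k` of Trust-IPM. -/
def trustPrimal {n m : ℕ} (a : Fin m → E n → ℝ) (p : Params) (sol : ℕ → E n → ℝ → E n)
    (x0 : E n) (k : ℕ) : E n :=
  nextPrimal a p (trustIterate a p sol x0 k) (trustDir a p sol x0 k)

/-- The point `y⁺` of iteration `k` of Trust-IPM. -/
def trustDual {n m : ℕ} (a : Fin m → E n → ℝ) (p : Params) (sol : ℕ → E n → ℝ → E n)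
    (x0 : E n) (k : ℕ) : Fin m → ℝ :=
  nextDual a p (trustIterate a p sol x0 k) (trustDir a p sol x0 k)

/-- The termination test of iteration `k` of Trust-IPM: `(x⁺, y⁺)` is an approximate
second-order Fritz John point. -/
def trustTest {n m : ℕ} (f : E n → ℝ) (a : Fin m → E n → ℝ) (p : Params)
    (sol : ℕ → E n → ℝ → E n) (x0 : E n) (k : ℕ) : Prop :=
  FJ1 f a p.μ p.τl p.τc (trustPrimal a p sol x0 k) (trustDual a p sol x0 k) ∧
    FJ2 f a p.μ p.τl (trustPrimal a p sol x0 k) (trustDual a p sol x0 k)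

/-- Trust-IPM started at `x0` returns `(x, y)` after exactly `N` iterations, i.e. after `N`
trust region subproblem solves (iterations `0, …, N - 1`, the last of which is the first one to
pass the termination test). -/
def TrustIPMReturns {n m : ℕ} (f : E n → ℝ) (a : Fin m → E n → ℝ) (p : Params)
    (sol : ℕ → E n → ℝ → E n) (x0 : E n) (N : ℕ) (x : E n) (y : Fin m → ℝ) : Prop :=
  ∃ k : ℕ, N = k + 1 ∧ (∀ l < k, ¬ trustTest f a p sol x0 l) ∧ trustTest f a p sol x0 k ∧
    x = trustPrimal a p sol x0 k ∧ y = trustDual a p sol x0 k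

/-! ### Annealed-IPM -/

/-- Annealed-IPM started at `x0` with initial barrier parameter `μ0` and tolerance `ε` returns
`x` after exactly `N` unit operations. `gen j μ z c z' y'` says that the call of the inner method
in outer iteration `j`, with barrier parameter `μ` and starting point `z`, returns `(z', y')`
after `c` unit operations. Outer iteration `j` uses `μ_j = μ0 / 2 ^ j`, and the method stops
after the first `j` with `2 μ_j m ≤ ε`. -/
def AnnealedIPMReturns {n m : ℕ}
    (gen : ℕ → ℝ → E n → ℕ → E n → (Fin m → ℝ) → Prop)
    (μ0 : ℝ) (x0 : E n) (ε : ℝ) (N : ℕ) (x : E n) : Prop :=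
  ∃ (k : ℕ) (xs : ℕ → E n) (ys : ℕ → Fin m → ℝ) (c : ℕ → ℕ),
    xs 0 = x0 ∧
    (∀ j ≤ k, gen j (μ0 / 2 ^ j) (xs j) (c j) (xs (j + 1)) (ys (j + 1))) ∧
    (∀ j < k, ε < 2 * (μ0 / 2 ^ j) * m) ∧
    2 * (μ0 / 2 ^ k) * m ≤ ε ∧
    x = xs (k + 1) ∧
    N = ∑ j ∈ Finset.range (k + 1), c j

/-! ### Parameter settings in the convex case -/

/-- `τ_l = m / (R ζ^{1/2})`. -/
def tauL (m : ℕ) (R ζ : ℝ) : ℝ := m / (R * Real.sqrt ζ)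

/-- `τ_c = (τ_l² μ / L₁)^{1/3}`. -/
def tauC (L1 τl μ : ℝ) : ℝ := (τl ^ 2 * μ / L1) ^ (1 / 3 : ℝ)

/-- The initial barrier parameter
`μ⁽⁰⁾ = min {L₁ R² ζ / m², L₁⁴ m / (R L₂³ √ζ)}`. -/
def muInit (m : ℕ) (L1 L2 R ζ : ℝ) : ℝ :=
  min (L1 * R ^ 2 * ζ / m ^ 2) (L1 ^ 4 * m / (R * L2 ^ 3 * Real.sqrt ζ))

/-- The parameters of the call of Trust-IPM with barrier parameter `μ`:
`η_s = θ (τ_l² μ / L₁)^{1/3}` and `η_x = θ (τ_l² μ / L₁)^{1/6}` with `θ = 1/20`. -/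
def convexParams (L1 τl μ : ℝ) : Params where
  μ := μ
  τl := τl
  τc := tauC L1 τl μ
  L1 := L1
  ηs := 1 / 20 * (τl ^ 2 * μ / L1) ^ (1 / 3 : ℝ)
  ηx := 1 / 20 * (τl ^ 2 * μ / L1) ^ (1 / 6 : ℝ)

/-- Trust-IPM with these parameters, as the inner method of Annealed-IPM. -/
def convexGen {n m : ℕ} (f : E n → ℝ) (a : Fin m → E n → ℝ) (L1 τl : ℝ) (sol : Solver n) :
    ℕ → ℝ → E n → ℕ → E n → (Fin m → ℝ) → Prop :=
  fun j μ => TrustIPMReturns f a (convexParams L1 τl μ) (fun k => sol j k μ)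

/-- `log⁺ t = max {log t, 1}`. -/
def logPlus (t : ℝ) : ℝ := max (Real.log t) 1

end

end IPM

namespace IPM

open Set Filter Topology

/-! ### One-dimensional estimates -/

/-! Write `κ` for `tauC`, so that `κ ^ 3 = τl ^ 2 * μ / L1`. The argument has two layers. Inside one
call of Trust-IPM, every iteration that fails the test lowers `ψ_μ` by at least `μ * κ ^ 2 / 2000`.
Across calls, each returned point is a warm start for the halved barrier parameter, with
suboptimality at most `4 * m * μ` measured in the new `μ`. A warm-started call therefore costs `O(m
/ κ ^ 2 + 1)` subproblems, and there are `O(log⁺)` calls. The first call alone pays for the initial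
suboptimality.

Decrease (`SmoothConvex.iteration`). The radius and the step size keep the relative slack changes
below `κ / 20` in Euclidean norm and the linearization errors of the slacks below `κ / 800` in `ℓ¹`
norm. Hence the quadratic model predicts `ψ_μ` up to `μ * κ ^ 2 / 2000` (`barrier_sub_le_model`). If
the step is truncated, convexity gives `∇²ψ_μ ⪰ μ ∇aᵀ S⁻² ∇a`, and the model drops by `μ * κ ^ 2 /
800`. If the full step is taken, complementarity holds automatically, so failure means a large
Lagrangian gradient. This gradient is close to the gradient of the model at the step
(`norm_lagrangian_grad_le`), whose norm times `r` bounds the model decrease from below by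
optimality. The second-order half of the test is free, since `ψ_μ` is convex.

Warm start and optimality. At a returned point, convexity of the Lagrangian in `x`, the bound `ζ` on
the dual variables and the diameter `R` give `f x - f z ≤ m * μ + ∑ y_i (a_i x - a_i z)`; here `τl`
is chosen so that `τl * μ * √ζ * R = m * μ`. Concavity of the constraints gives the one-sided bound
`y_i a_i x ≤ μ`, hence a gap of at most `2 * m * μ`, which is exactly the stopping rule. With `y_i
a_i x ≥ μ / 2` and `log t ≤ t - 1` the same inequality bounds the gap of `ψ_{μ/2}`.

Since smoothness is assumed only along lines, Fréchet derivatives of order one and two and their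
Lipschitz bounds have to be derived first; `SmoothOn` collects them. -/

lemma nonpos_of_eventually_mul_le_sq {A C : ℝ}
    (h : ∀ᶠ t in 𝓝[>] (0 : ℝ), A * t ≤ C * t ^ 2) : A ≤ 0 := by
  have h1 : ∀ᶠ t in 𝓝[>] (0 : ℝ), A ≤ C * t := by
    filter_upwards [h, self_mem_nhdsWithin] with t ht ht0
    have : 0 < t := ht0
    exact le_of_mul_le_mul_right (by linarith [ht, sq t, mul_assoc C t t]) this
  have h2 : Tendsto (fun t : ℝ => C * t) (𝓝[>] 0) (𝓝 0) := by
    have : Continuous fun t : ℝ => C * t := by fun_prop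
    simpa using (this.tendsto 0).mono_left nhdsWithin_le_nhds
  exact ge_of_tendsto h2 h1

lemma eq_zero_of_eventually_abs_mul_le_sq {A C : ℝ}
    (h : ∀ᶠ t in 𝓝[>] (0 : ℝ), |A * t| ≤ C * t ^ 2) : A = 0 := by
  refine le_antisymm (nonpos_of_eventually_mul_le_sq (C := C) ?_) ?_
  · filter_upwards [h] with t ht using (le_abs_self _).trans ht
  · have : -A ≤ 0 := nonpos_of_eventually_mul_le_sq (C := C) (by
      filter_upwards [h] with t ht
      rw [neg_mul]
      exact (neg_le_abs _).trans ht)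
    linarith

/-- One integration of a monomial bound. Iterating it gives the Taylor estimates below; the
vector-valued form is needed later for gradients. -/
lemma norm_le_of_norm_deriv_le_pow {F : Type*} [NormedAddCommGroup F] [NormedSpace ℝ F]
    {h h' : ℝ → F} {T C : ℝ} (k : ℕ)
    (hd : ∀ t ∈ Icc 0 T, HasDerivAt h (h' t) t) (h0 : h 0 = 0)
    (hb : ∀ t ∈ Icc 0 T, ‖h' t‖ ≤ C * t ^ k) :
    ∀ t ∈ Icc 0 T, ‖h t‖ ≤ C / (k + 1) * t ^ (k + 1) := by
  intro t ht
  refine image_norm_le_of_norm_deriv_right_le_deriv_boundary (f := h) (f' := h') (a := 0) (b := T)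
    (B := fun t => C / (k + 1) * t ^ (k + 1)) (B' := fun t => C * t ^ k)
    (fun s hs => (hd s hs).continuousAt.continuousWithinAt)
    (fun s hs => (hd s (Ico_subset_Icc_self hs)).hasDerivWithinAt) ?_ ?_
    (fun s hs => hb s (Ico_subset_Icc_self hs)) ht
  · simp [h0]
  · intro s
    have := ((hasDerivAt_pow (k + 1) s).const_mul (C / (k + 1)))
    refine this.congr_deriv ?_
    have : (k : ℝ) + 1 ≠ 0 := by positivity
    push_cast
    field_simp

lemma taylor_first {g g1 g2 : ℝ → ℝ} {T C : ℝ} (hT : 0 ≤ T)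
    (h1 : ∀ t ∈ Icc 0 T, HasDerivAt g (g1 t) t) (h2 : ∀ t ∈ Icc 0 T, HasDerivAt g1 (g2 t) t)
    (hb : ∀ t ∈ Icc 0 T, |g2 t| ≤ C) : |g T - g 0 - T * g1 0| ≤ C / 2 * T ^ 2 := by
  have e1 := norm_le_of_norm_deriv_le_pow (h := fun t => g1 t - g1 0) (h' := g2) (C := C) 0
    (fun t ht => (h2 t ht).sub_const _) (by simp) (fun t ht => by simpa using hb t ht)
  have e0 := norm_le_of_norm_deriv_le_pow (h := fun t => g t - g 0 - t * g1 0)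
    (h' := fun t => g1 t - g1 0) (C := C) 1
    (fun t ht => by
      exact (((h1 t ht).sub_const (g 0)).sub ((hasDerivAt_id t).mul_const (g1 0))).congr_deriv
        (by simp))
    (by simp) (fun t ht => by simpa using e1 t ht)
  have := e0 T ⟨hT, le_rfl⟩
  norm_num at this
  exact this

lemma taylor_second {g g1 g2 g3 : ℝ → ℝ} {T C : ℝ} (hT : 0 ≤ T)
    (h1 : ∀ t ∈ Icc 0 T, HasDerivAt g (g1 t) t) (h2 : ∀ t ∈ Icc 0 T, HasDerivAt g1 (g2 t) t)
    (h3 : ∀ t ∈ Icc 0 T, HasDerivAt g2 (g3 t) t)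
    (hb : ∀ t ∈ Icc 0 T, |g3 t| ≤ C) :
    |g T - g 0 - T * g1 0 - T ^ 2 / 2 * g2 0| ≤ C / 6 * T ^ 3 := by
  have e2 := norm_le_of_norm_deriv_le_pow (h := fun t => g2 t - g2 0) (h' := g3) (C := C) 0
    (fun t ht => (h3 t ht).sub_const _) (by simp) (fun t ht => by simpa using hb t ht)
  have e1 := norm_le_of_norm_deriv_le_pow (h := fun t => g1 t - g1 0 - t * g2 0)
    (h' := fun t => g2 t - g2 0) (C := C) 1
    (fun t ht => by
      exact (((h2 t ht).sub_const (g1 0)).sub ((hasDerivAt_id t).mul_const (g2 0))).congr_deriv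
        (by simp))
    (by simp) (fun t ht => by simpa using e2 t ht)
  have e0 := norm_le_of_norm_deriv_le_pow (h := fun t => g t - g 0 - t * g1 0 - t ^ 2 / 2 * g2 0)
    (h' := fun t => g1 t - g1 0 - t * g2 0) (C := C / 2) 2
    (fun t ht => by
      have := (((h1 t ht).sub_const (g 0)).sub ((hasDerivAt_id t).mul_const (g1 0))).sub
        (((hasDerivAt_pow 2 t).div_const 2).mul_const (g2 0))
      refine this.congr_deriv ?_
      push_cast
      ring)
    (by simp) (fun t ht => by
      have := e1 t ht
      norm_num at this ⊢
      exact this)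
  have := e0 T ⟨hT, le_rfl⟩
  norm_num at this ⊢
  calc _ ≤ _ := this
    _ = _ := by ring

/-- A pointwise local Lipschitz bound integrates along the segment by comparing Dini derivatives.
The comparison needs a strict inequality, hence the loss from `c` to `c'`. -/
lemma norm_sub_le_of_eventually_norm_sub_le {F : Type*} [NormedAddCommGroup F] {G : ℝ → F}
    {c c' : ℝ} (hc : c < c')
    (hloc : ∀ t ∈ Icc (0 : ℝ) 1, ∀ᶠ s in 𝓝 t, ‖G s - G t‖ ≤ c * |s - t|) :
    ‖G 1 - G 0‖ ≤ c' := by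
  have := image_norm_le_of_liminf_right_slope_norm_lt_deriv_boundary (a := 0) (b := 1)
    (f := fun t : ℝ => G t - G 0)
    (f' := fun _ => c) ?_ ?_ (B := fun t => c' * t)
    (B' := fun _ => c') (by simp) (by fun_prop) ?_ ?_ (right_mem_Icc.2 zero_le_one)
  · simpa using this
  · intro t ht
    refine ContinuousAt.continuousWithinAt ?_
    rw [ContinuousAt, tendsto_iff_norm_sub_tendsto_zero]
    have hc : Tendsto (fun s : ℝ => c * |s - t|) (𝓝 t) (𝓝 0) := by
      have : Continuous fun s : ℝ => c * |s - t| := by fun_prop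
      simpa using this.tendsto t
    refine squeeze_zero' (Eventually.of_forall fun s => norm_nonneg _) ?_ hc
    filter_upwards [hloc t ht] with s hs
    simpa using hs
  · intro t ht r hr
    refine Eventually.frequently ?_
    filter_upwards [nhdsWithin_le_nhds (hloc t (Ico_subset_Icc_self ht)),
      self_mem_nhdsWithin] with s hs hst
    have hst : 0 < s - t := sub_pos.2 hst
    refine lt_of_le_of_lt ?_ hr
    rw [slope_def_field, div_le_iff₀ hst]
    rw [abs_of_pos hst] at hs
    refine le_trans ?_ hs
    refine (norm_sub_norm_le _ _).trans (le_of_eq ?_)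
    rw [sub_sub_sub_cancel_right]
  · intro t _
    exact ((hasDerivAt_id t).const_mul c').hasDerivWithinAt.congr_deriv (by simp)
  · intro t _ _
    exact hc

/-! ### Taylor expansions along segments -/

variable {n m : ℕ}

/-- The second derivative of `w` at `x` along the line in direction `v`. -/
noncomputable def lineDeriv2 (w : E n → ℝ) (x v : E n) : ℝ :=
  deriv (deriv fun t : ℝ => w (x + t • v)) 0

lemma lineDeriv2_smul (w : E n → ℝ) (x v : E n) (c : ℝ) :
    lineDeriv2 w x (c • v) = c ^ 2 * lineDeriv2 w x v := by
  unfold lineDeriv2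
  have h1 : (fun t : ℝ => w (x + t • c • v)) = fun t => (fun s : ℝ => w (x + s • v)) (c * t) := by
    funext t; simp only [smul_smul, mul_comm]
  have h2 : (deriv fun t : ℝ => (fun s : ℝ => w (x + s • v)) (c * t)) =
      fun t => c * (fun r => deriv (fun s : ℝ => w (x + s • v)) r) (c * t) := by
    funext t; exact deriv_comp_mul_left c (fun s : ℝ => w (x + s • v)) t
  rw [h1, h2, deriv_const_mul_field, deriv_comp_mul_left]
  simp [sq, mul_assoc]

lemma lineDeriv2_neg (w : E n → ℝ) (x v : E n) : lineDeriv2 w x (-v) = lineDeriv2 w x v := by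
  have := lineDeriv2_smul w x v (-1)
  simpa using this

lemma exists_unit_smul (h : E n) : ∃ v : E n, ‖v‖ ≤ 1 ∧ h = ‖h‖ • v := by
  by_cases h0 : h = 0
  · exact ⟨0, by simp, by simp [h0]⟩
  · refine ⟨‖h‖⁻¹ • h, ?_, ?_⟩
    · rw [norm_smul, norm_inv, norm_norm, inv_mul_cancel₀ (norm_ne_zero_iff.2 h0)]
    · rw [smul_smul, mul_inv_cancel₀ (norm_ne_zero_iff.2 h0), one_smul]

lemma Convex.add_smul_mem_of_norm {X : Set (E n)} (hX : Convex ℝ X) {x v : E n} {T : ℝ}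
    (hx : x ∈ X) (hxh : x + T • v ∈ X) {t : ℝ} (ht : t ∈ Icc 0 T) : x + t • v ∈ X := by
  rcases eq_or_lt_of_le (ht.1.trans ht.2) with hT | hT
  · have : t = 0 := le_antisymm (hT ▸ ht.2) ht.1
    simpa [this] using hx
  · have := hX.add_smul_mem hx hxh (t := t / T)
      ⟨div_nonneg ht.1 hT.le, (div_le_one hT).2 ht.2⟩
    rwa [smul_smul, div_mul_cancel₀ _ hT.ne'] at this

lemma LipschitzDeriv.line {w : E n → ℝ} {X : Set (E n)} {L : ℝ} {p : ℕ}
    (hw : LipschitzDeriv p L w X) {x v : E n} (hx : x ∈ X) (hv : ‖v‖ ≤ 1) {t : ℝ}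
    (ht : x + t • v ∈ X) :
    (∀ q ≤ p, HasDerivAt (iteratedDeriv q fun θ : ℝ => w (x + θ • v))
      (iteratedDeriv (q + 1) (fun θ : ℝ => w (x + θ • v)) t) t) ∧
    |iteratedDeriv (p + 1) (fun θ : ℝ => w (x + θ • v)) t| ≤ L := by
  obtain ⟨h1, h2⟩ := hw x hx v hv t ht
  refine ⟨fun q hq => ?_, h2⟩
  rw [iteratedDeriv_succ]
  exact (h1 q hq).hasDerivAt

lemma LipschitzDeriv.abs_sub_lineDeriv_le {w : E n → ℝ} {X : Set (E n)} {L : ℝ}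
    (hX : Convex ℝ X) (hw : LipschitzDeriv 1 L w X) {x h : E n} (hx : x ∈ X) (hh : x + h ∈ X) :
    |w (x + h) - w x - lineDeriv ℝ w x h| ≤ L / 2 * ‖h‖ ^ 2 := by
  obtain ⟨v, hv, hhv⟩ := exists_unit_smul h
  have hseg : ∀ t ∈ Icc 0 ‖h‖, x + t • v ∈ X := fun t ht =>
    Convex.add_smul_mem_of_norm hX hx (hhv ▸ hh) ht
  have := taylor_first (g := fun t : ℝ => w (x + t • v)) (norm_nonneg h)
    (fun t ht => by simpa using (hw.line hx hv (hseg t ht)).1 0 (by simp))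
    (fun t ht => (hw.line hx hv (hseg t ht)).1 1 le_rfl)
    (fun t ht => (hw.line hx hv (hseg t ht)).2)
  have e : lineDeriv ℝ w x h = ‖h‖ * iteratedDeriv 1 (fun t : ℝ => w (x + t • v)) 0 := by
    conv_lhs => rw [hhv, lineDeriv_smul]
    simp [lineDeriv, iteratedDeriv_one]
  rw [e]
  simpa [← hhv] using this

lemma LipschitzDeriv.abs_sub_lineDeriv2_le {w : E n → ℝ} {X : Set (E n)} {L : ℝ}
    (hX : Convex ℝ X) (hw : LipschitzDeriv 2 L w X) {x h : E n} (hx : x ∈ X) (hh : x + h ∈ X) :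
    |w (x + h) - w x - lineDeriv ℝ w x h - 1 / 2 * lineDeriv2 w x h| ≤ L / 6 * ‖h‖ ^ 3 := by
  obtain ⟨v, hv, hhv⟩ := exists_unit_smul h
  have hseg : ∀ t ∈ Icc 0 ‖h‖, x + t • v ∈ X := fun t ht =>
    Convex.add_smul_mem_of_norm hX hx (hhv ▸ hh) ht
  have := taylor_second (g := fun t : ℝ => w (x + t • v)) (norm_nonneg h)
    (fun t ht => by simpa using (hw.line hx hv (hseg t ht)).1 0 (by simp))
    (fun t ht => (hw.line hx hv (hseg t ht)).1 1 (by simp))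
    (fun t ht => (hw.line hx hv (hseg t ht)).1 2 le_rfl)
    (fun t ht => (hw.line hx hv (hseg t ht)).2)
  have e : lineDeriv ℝ w x h = ‖h‖ * iteratedDeriv 1 (fun t : ℝ => w (x + t • v)) 0 := by
    conv_lhs => rw [hhv, lineDeriv_smul]
    simp [lineDeriv, iteratedDeriv_one]
  have e2 : lineDeriv2 w x h = ‖h‖ ^ 2 * iteratedDeriv 2 (fun t : ℝ => w (x + t • v)) 0 := by
    conv_lhs => rw [hhv, lineDeriv2_smul]
    simp [lineDeriv2, iteratedDeriv_succ]
  rw [e, e2]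
  simp only [← hhv, zero_smul, add_zero] at this
  convert this using 2
  norm_num
  ring

lemma LipschitzDeriv.abs_lineDeriv2_le {w : E n → ℝ} {X : Set (E n)} {L : ℝ}
    (hw : LipschitzDeriv 1 L w X) {x : E n} (hx : x ∈ X) (h : E n) :
    |lineDeriv2 w x h| ≤ L * ‖h‖ ^ 2 := by
  obtain ⟨v, hv, hhv⟩ := exists_unit_smul h
  have h1 := (hw.line hx hv (t := 0) (by simpa using hx)).2
  have e2 : lineDeriv2 w x h = ‖h‖ ^ 2 * iteratedDeriv 2 (fun t : ℝ => w (x + t • v)) 0 := by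
    conv_lhs => rw [hhv, lineDeriv2_smul]
    simp [lineDeriv2, iteratedDeriv_succ]
  rw [e2, abs_mul, abs_of_nonneg (sq_nonneg _), mul_comm]
  exact mul_le_mul_of_nonneg_right h1 (sq_nonneg _)

/-! ### First and second Fréchet derivatives -/

lemma eventually_add_smul_mem {X : Set (E n)} (hX : IsOpen X) {x : E n} (hx : x ∈ X) (u : E n) :
    ∀ᶠ t in 𝓝[>] (0 : ℝ), x + t • u ∈ X := by
  have hc : Continuous fun t : ℝ => x + t • u := by fun_prop
  refine nhdsWithin_le_nhds (hc.continuousAt.eventually_mem (hX.mem_nhds ?_))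
  simpa using hx

lemma eventually_add_mem {X : Set (E n)} (hX : IsOpen X) {x : E n} (hx : x ∈ X) :
    ∀ᶠ h in 𝓝 (0 : E n), x + h ∈ X := by
  have hc : Continuous fun t : E n => x + t := by fun_prop
  refine (hc.continuousAt.eventually_mem (hX.mem_nhds ?_))
  simpa using hx

/-- With `u = z + d` and `v = z - d`, expand `w` at `x + t • z` in the directions `± t • d`: the
linear terms cancel, so `w (x + t • u) + w (x + t • v) - 2 * w (x + t • z)` is `O(t ^ 2)`. Expanding
the same combination at `x` shows that its linear coefficient vanishes. -/
lemma LipschitzDeriv.lineDeriv_add {w : E n → ℝ} {X : Set (E n)} {L : ℝ}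
    (hXo : IsOpen X) (hX : Convex ℝ X) (hw : LipschitzDeriv 1 L w X) {x : E n} (hx : x ∈ X)
    (u v : E n) : lineDeriv ℝ w x (u + v) = lineDeriv ℝ w x u + lineDeriv ℝ w x v := by
  set z := (1 / 2 : ℝ) • (u + v)
  set d := (1 / 2 : ℝ) • (u - v)
  have hu : u = z + d := by simp only [z, d]; module
  have hv : v = z - d := by simp only [z, d]; module
  suffices lineDeriv ℝ w x u + lineDeriv ℝ w x v - 2 * lineDeriv ℝ w x z = 0 by
    have e : lineDeriv ℝ w x (u + v) = 2 * lineDeriv ℝ w x z := by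
      have : u + v = (2 : ℝ) • z := by simp only [z]; module
      rw [this, lineDeriv_smul, smul_eq_mul]
    linarith
  refine eq_zero_of_eventually_abs_mul_le_sq
    (C := L / 2 * ‖u‖ ^ 2 + L / 2 * ‖v‖ ^ 2 + 2 * (L / 2 * ‖z‖ ^ 2) + 2 * (L / 2 * ‖d‖ ^ 2)) ?_
  filter_upwards [eventually_add_smul_mem hXo hx u, eventually_add_smul_mem hXo hx v,
    eventually_add_smul_mem hXo hx z] with t hu' hv' hz'
  have e1 := hw.abs_sub_lineDeriv_le hX hx hu'
  have e2 := hw.abs_sub_lineDeriv_le hX hx hv'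
  have e3 := hw.abs_sub_lineDeriv_le hX hx hz'
  have a4 : x + t • z + t • d = x + t • u := by rw [hu]; module
  have a5 : x + t • z + (-t) • d = x + t • v := by rw [hv]; module
  have e4 := hw.abs_sub_lineDeriv_le hX hz' (h := t • d) (by rwa [a4])
  have e5 := hw.abs_sub_lineDeriv_le hX hz' (h := (-t) • d) (by rwa [a5])
  rw [a4] at e4
  rw [a5] at e5
  simp only [lineDeriv_smul, norm_smul, smul_eq_mul, mul_pow, Real.norm_eq_abs, sq_abs,
    abs_neg] at e1 e2 e3 e4 e5
  rw [abs_le] at *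
  constructor <;> linarith [e1.1, e1.2, e2.1, e2.2, e3.1, e3.2, e4.1, e4.2, e5.1, e5.2]

/-- Additivity makes the directional derivative a linear map, and the quadratic remainder is uniform
over directions. -/
lemma LipschitzDeriv.differentiableAt {w : E n → ℝ} {X : Set (E n)} {L : ℝ}
    (hXo : IsOpen X) (hX : Convex ℝ X) (hw : LipschitzDeriv 1 L w X) {x : E n} (hx : x ∈ X) :
    DifferentiableAt ℝ w x := by
  let l : E n →ₗ[ℝ] ℝ :=
    { toFun := lineDeriv ℝ w x
      map_add' := hw.lineDeriv_add hXo hX hx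
      map_smul' := fun c v => lineDeriv_smul }
  refine HasFDerivAt.differentiableAt (f' := LinearMap.toContinuousLinearMap l) ?_
  rw [hasFDerivAt_iff_isLittleO_nhds_zero]
  refine Asymptotics.IsBigO.trans_isLittleO (g := fun h : E n => ‖h‖ ^ 2) ?_ ?_
  · refine Asymptotics.IsBigO.of_bound (L / 2) ?_
    filter_upwards [eventually_add_mem hXo hx] with h hh
    simpa [l] using hw.abs_sub_lineDeriv_le hX hx hh
  · exact Asymptotics.isLittleO_norm_pow_id one_lt_two

lemma LipschitzDeriv.abs_sub_fderiv_le {w : E n → ℝ} {X : Set (E n)} {L : ℝ}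
    (hXo : IsOpen X) (hX : Convex ℝ X) (hw : LipschitzDeriv 1 L w X) {x h : E n} (hx : x ∈ X)
    (hh : x + h ∈ X) : |w (x + h) - w x - fderiv ℝ w x h| ≤ L / 2 * ‖h‖ ^ 2 := by
  rw [← (hw.differentiableAt hXo hX hx).lineDeriv_eq_fderiv]
  exact hw.abs_sub_lineDeriv_le hX hx hh

/-- The polarization of `lineDeriv2`. -/
noncomputable def polarHess (w : E n → ℝ) (x u v : E n) : ℝ :=
  (lineDeriv2 w x (u + v) - lineDeriv2 w x (u - v)) / 4

lemma polarHess_comm (w : E n → ℝ) (x u v : E n) : polarHess w x u v = polarHess w x v u := by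
  unfold polarHess
  rw [add_comm u v, ← neg_sub v u, lineDeriv2_neg]

lemma polarHess_self (w : E n → ℝ) (x u : E n) : polarHess w x u u = lineDeriv2 w x u := by
  unfold polarHess
  have h1 : u + u = (2 : ℝ) • u := by module
  have h2 : u - u = (0 : ℝ) • u := by module
  rw [h1, h2, lineDeriv2_smul, lineDeriv2_smul]
  ring

lemma polarHess_smul_smul (w : E n → ℝ) (x u v : E n) (c : ℝ) :
    polarHess w x (c • u) (c • v) = c ^ 2 * polarHess w x u v := by
  unfold polarHess
  rw [← smul_add, ← smul_sub, lineDeriv2_smul, lineDeriv2_smul]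
  ring

section Smooth

variable {w : E n → ℝ} {X : Set (E n)} {L1 L2 : ℝ}

/-- Expand `w (x + h ± v)` to third order both from `x` and from `x + h`. The difference of the two
signs isolates the change of the gradient; the sum, together with the expansion of `w (x + h)`,
isolates the change of the quadratic form. -/
lemma abs_fderiv_sub_polarHess_le_aux (hXo : IsOpen X) (hX : Convex ℝ X)
    (hw1 : LipschitzDeriv 1 L1 w X) (hw2 : LipschitzDeriv 2 L2 w X) (hL2 : 0 ≤ L2) {x h v : E n}
    (hx : x ∈ X) (hh : x + h ∈ X) (hp : x + (h + v) ∈ X) (hm : x + (h - v) ∈ X) :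
    |fderiv ℝ w (x + h) v - fderiv ℝ w x v - polarHess w x h v| ≤
        L2 / 3 * (‖h‖ + ‖v‖) ^ 3 ∧
      |(lineDeriv2 w x (h + v) + lineDeriv2 w x (h - v)) / 2 - lineDeriv2 w x h
        - lineDeriv2 w (x + h) v| ≤ L2 * (‖h‖ + ‖v‖) ^ 3 := by
  have hp' : x + h + v = x + (h + v) := by abel
  have hm' : x + h + -v = x + (h - v) := by abel
  have e1 := hw2.abs_sub_lineDeriv2_le hX hx hp
  have e2 := hw2.abs_sub_lineDeriv2_le hX hx hm
  have e3 := hw2.abs_sub_lineDeriv2_le hX hh (h := v) (by rwa [hp'])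
  have e4 := hw2.abs_sub_lineDeriv2_le hX hh (h := -v) (by rwa [hm'])
  have e5 := hw2.abs_sub_lineDeriv2_le hX hx hh
  simp only [(hw1.differentiableAt hXo hX hx).lineDeriv_eq_fderiv,
    (hw1.differentiableAt hXo hX hh).lineDeriv_eq_fderiv, map_add, map_sub, map_neg, norm_neg,
    hp', hm', lineDeriv2_neg] at e1 e2 e3 e4 e5
  have b1 : L2 / 6 * ‖h + v‖ ^ 3 ≤ L2 / 6 * (‖h‖ + ‖v‖) ^ 3 := by
    gcongr; exact norm_add_le h v
  have b2 : L2 / 6 * ‖h - v‖ ^ 3 ≤ L2 / 6 * (‖h‖ + ‖v‖) ^ 3 := by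
    gcongr; exact norm_sub_le h v
  have b3 : L2 / 6 * ‖v‖ ^ 3 ≤ L2 / 6 * (‖h‖ + ‖v‖) ^ 3 := by
    gcongr; exact le_add_of_nonneg_left (norm_nonneg h)
  have b4 : L2 / 6 * ‖h‖ ^ 3 ≤ L2 / 6 * (‖h‖ + ‖v‖) ^ 3 := by
    gcongr; exact le_add_of_nonneg_right (norm_nonneg v)
  unfold polarHess
  rw [abs_le] at e1 e2 e3 e4 e5
  refine ⟨abs_le.2 ⟨?_, ?_⟩, abs_le.2 ⟨?_, ?_⟩⟩ <;> linarith

lemma abs_fderiv_sub_polarHess_le (hXo : IsOpen X) (hX : Convex ℝ X)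
    (hw1 : LipschitzDeriv 1 L1 w X) (hw2 : LipschitzDeriv 2 L2 w X) (hL2 : 0 ≤ L2) {x : E n}
    (hx : x ∈ X) (u v : E n) :
    ∀ᶠ t in 𝓝[>] (0 : ℝ), |fderiv ℝ w (x + t • u) v - fderiv ℝ w x v - t * polarHess w x u v| ≤
        L2 / 3 * (‖u‖ + ‖v‖) ^ 3 * t ^ 2 := by
  filter_upwards [eventually_add_smul_mem hXo hx u, eventually_add_smul_mem hXo hx (u + v),
    eventually_add_smul_mem hXo hx (u - v), self_mem_nhdsWithin] with t h1 h2 h3 ht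
  have ht0 : 0 < t := ht
  have h := (abs_fderiv_sub_polarHess_le_aux hXo hX hw1 hw2 hL2 hx h1
    (v := t • v) (by rwa [← smul_add]) (by rwa [← smul_sub])).1
  rw [polarHess_smul_smul, map_smul, map_smul, norm_smul, norm_smul, Real.norm_eq_abs,
    abs_of_pos ht0, smul_eq_mul, smul_eq_mul] at h
  refine le_of_mul_le_mul_left ?_ ht0
  calc _ = |t * (fderiv ℝ w (x + t • u) v - fderiv ℝ w x v - t * polarHess w x u v)| := by
        rw [abs_mul, abs_of_pos ht0]
    _ = |t * fderiv ℝ w (x + t • u) v - t * fderiv ℝ w x v - t ^ 2 * polarHess w x u v| := by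
        congr 1; ring
    _ ≤ _ := h
    _ = _ := by ring

/-- By the preceding estimate `polarHess w x u` is the derivative of `fderiv ℝ w` along `u`, so it
inherits linearity in `v` from the gradient. -/
lemma polarHess_add_right (hXo : IsOpen X) (hX : Convex ℝ X)
    (hw1 : LipschitzDeriv 1 L1 w X) (hw2 : LipschitzDeriv 2 L2 w X) (hL2 : 0 ≤ L2) {x : E n}
    (hx : x ∈ X) (u v v' : E n) :
    polarHess w x u (v + v') = polarHess w x u v + polarHess w x u v' := by
  suffices polarHess w x u (v + v') - polarHess w x u v - polarHess w x u v' = 0 by linarith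
  refine eq_zero_of_eventually_abs_mul_le_sq (C := L2 / 3 * (‖u‖ + ‖v + v'‖) ^ 3 +
    L2 / 3 * (‖u‖ + ‖v‖) ^ 3 + L2 / 3 * (‖u‖ + ‖v'‖) ^ 3) ?_
  filter_upwards [abs_fderiv_sub_polarHess_le hXo hX hw1 hw2 hL2 hx u (v + v'),
    abs_fderiv_sub_polarHess_le hXo hX hw1 hw2 hL2 hx u v,
    abs_fderiv_sub_polarHess_le hXo hX hw1 hw2 hL2 hx u v'] with t h1 h2 h3
  rw [map_add, map_add] at h1
  rw [abs_le] at *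
  constructor <;> linarith

lemma polarHess_smul_right (hXo : IsOpen X) (hX : Convex ℝ X)
    (hw1 : LipschitzDeriv 1 L1 w X) (hw2 : LipschitzDeriv 2 L2 w X) (hL2 : 0 ≤ L2) {x : E n}
    (hx : x ∈ X) (u v : E n) (c : ℝ) :
    polarHess w x u (c • v) = c * polarHess w x u v := by
  suffices polarHess w x u (c • v) - c * polarHess w x u v = 0 by linarith
  refine eq_zero_of_eventually_abs_mul_le_sq (C := L2 / 3 * (‖u‖ + ‖c • v‖) ^ 3 +
    |c| * (L2 / 3 * (‖u‖ + ‖v‖) ^ 3)) ?_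
  filter_upwards [abs_fderiv_sub_polarHess_le hXo hX hw1 hw2 hL2 hx u (c • v),
    abs_fderiv_sub_polarHess_le hXo hX hw1 hw2 hL2 hx u v] with t h1 h2
  have h3 := mul_le_mul_of_nonneg_left h2 (abs_nonneg c)
  rw [← abs_mul] at h3
  rw [map_smul, map_smul, smul_eq_mul, smul_eq_mul] at h1
  rw [abs_le] at *
  constructor <;> linarith

/-- The second derivative of `w` as a bilinear map. -/
noncomputable def hessMap (hXo : IsOpen X) (hX : Convex ℝ X)
    (hw1 : LipschitzDeriv 1 L1 w X) (hw2 : LipschitzDeriv 2 L2 w X) (hL2 : 0 ≤ L2) {x : E n}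
    (hx : x ∈ X) : E n →L[ℝ] E n →L[ℝ] ℝ :=
  LinearMap.toContinuousBilinearMap <| LinearMap.mk₂ ℝ (polarHess w x)
    (fun u u' v => by
      simp only [polarHess_comm w x _ v, polarHess_add_right hXo hX hw1 hw2 hL2 hx])
    (fun c u v => by
      simp only [polarHess_comm w x _ v, polarHess_smul_right hXo hX hw1 hw2 hL2 hx, smul_eq_mul])
    (polarHess_add_right hXo hX hw1 hw2 hL2 hx)
    (fun c u v => polarHess_smul_right hXo hX hw1 hw2 hL2 hx u v c)

lemma hessMap_apply (hXo : IsOpen X) (hX : Convex ℝ X)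
    (hw1 : LipschitzDeriv 1 L1 w X) (hw2 : LipschitzDeriv 2 L2 w X) (hL2 : 0 ≤ L2) {x : E n}
    (hx : x ∈ X) (u v : E n) : hessMap hXo hX hw1 hw2 hL2 hx u v = polarHess w x u v := rfl

lemma eventually_add_add_mem (hXo : IsOpen X) {x : E n} (hx : x ∈ X) :
    ∀ᶠ h in 𝓝 (0 : E n), ∀ v : E n, ‖v‖ ≤ ‖h‖ → x + (h + v) ∈ X := by
  obtain ⟨ρ, hρ, hb⟩ := Metric.isOpen_iff.1 hXo x hx
  filter_upwards [Metric.ball_mem_nhds (0 : E n) (half_pos hρ)] with h hh v hv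
  apply hb
  rw [mem_ball_zero_iff] at hh
  rw [mem_ball_iff_norm, add_sub_cancel_left]
  linarith [norm_add_le h v]

lemma hasFDerivAt_fderiv (hXo : IsOpen X) (hX : Convex ℝ X)
    (hw1 : LipschitzDeriv 1 L1 w X) (hw2 : LipschitzDeriv 2 L2 w X) (hL2 : 0 ≤ L2) {x : E n}
    (hx : x ∈ X) :
    HasFDerivAt (fderiv ℝ w) (hessMap hXo hX hw1 hw2 hL2 hx) x := by
  rw [hasFDerivAt_iff_isLittleO_nhds_zero]
  refine Asymptotics.IsBigO.trans_isLittleO (g := fun h : E n => ‖h‖ ^ 2) ?_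
    (Asymptotics.isLittleO_norm_pow_id one_lt_two)
  refine Asymptotics.IsBigO.of_bound (L2 / 3 * 8) ?_
  filter_upwards [eventually_add_add_mem hXo hx] with h hh
  -- The error is cubic in `‖h‖ + ‖v‖`, so testing with `‖v‖ = ‖h‖` makes it `O(‖h‖ ^ 3)`;
  -- homogeneity in `v` then gives an operator norm of order `‖h‖ ^ 2`.
  have key : ∀ v : E n, ‖v‖ = ‖h‖ →
      |fderiv ℝ w (x + h) v - fderiv ℝ w x v - polarHess w x h v| ≤ L2 / 3 * 8 * ‖h‖ ^ 3 := by
    intro v hv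
    have := (abs_fderiv_sub_polarHess_le_aux hXo hX hw1 hw2 hL2 hx (h := h) (v := v)
      (by simpa using hh 0 (by simp)) (hh v hv.le)
      (by simpa [sub_eq_add_neg] using hh (-v) (by simp [hv]))).1
    rw [hv] at this
    calc _ ≤ _ := this
      _ = _ := by ring
  by_cases h0 : h = 0
  · simp [h0]
  have hn : 0 < ‖h‖ := norm_pos_iff.2 h0
  refine ContinuousLinearMap.opNorm_le_bound _ (by positivity) fun v => ?_
  by_cases hv0 : v = 0
  · simp [hv0]
  have hvn : 0 < ‖v‖ := norm_pos_iff.2 hv0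
  have h1 := key ((‖h‖ / ‖v‖) • v) (by
    rw [norm_smul, Real.norm_eq_abs, abs_of_pos (by positivity), div_mul_cancel₀ _ hvn.ne'])
  rw [polarHess_smul_right hXo hX hw1 hw2 hL2 hx, map_smul, map_smul, smul_eq_mul, smul_eq_mul,
    ← mul_sub, ← mul_sub, abs_mul, abs_of_pos (by positivity : 0 < ‖h‖ / ‖v‖),
    div_mul_eq_mul_div, div_le_iff₀ hvn] at h1
  have h2 : ‖(fderiv ℝ w (x + h) - fderiv ℝ w x - hessMap hXo hX hw1 hw2 hL2 hx h) v‖ =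
    |fderiv ℝ w (x + h) v - fderiv ℝ w x v - polarHess w x h v| := rfl
  rw [h2, norm_pow, norm_norm]
  refine le_of_mul_le_mul_left ?_ hn
  calc _ ≤ _ := h1
    _ = _ := by ring

lemma fderiv_fderiv_apply (hXo : IsOpen X) (hX : Convex ℝ X)
    (hw1 : LipschitzDeriv 1 L1 w X) (hw2 : LipschitzDeriv 2 L2 w X) (hL2 : 0 ≤ L2) {x : E n}
    (hx : x ∈ X) (u v : E n) : fderiv ℝ (fderiv ℝ w) x u v = polarHess w x u v := by
  rw [(hasFDerivAt_fderiv hXo hX hw1 hw2 hL2 hx).fderiv, hessMap_apply]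

lemma hessForm_eq (hXo : IsOpen X) (hX : Convex ℝ X)
    (hw1 : LipschitzDeriv 1 L1 w X) (hw2 : LipschitzDeriv 2 L2 w X) (hL2 : 0 ≤ L2) {x : E n}
    (hx : x ∈ X) (u : E n) : hessForm w x u = lineDeriv2 w x u := by
  rw [hessForm, fderiv_fderiv_apply hXo hX hw1 hw2 hL2 hx, polarHess_self]

/-! ### Operator-norm bounds and Lipschitz continuity of the Hessian. -/

lemma ContinuousLinearMap.norm_le_of_abs_self_le {B : E n →L[ℝ] E n →L[ℝ] ℝ}
    (hsymm : ∀ u v, B u v = B v u) {K : ℝ} (hK : 0 ≤ K) (hB : ∀ u, |B u u| ≤ K * ‖u‖ ^ 2) :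
    ‖B‖ ≤ K := by
  have key : ∀ u v : E n, ‖u‖ = ‖v‖ → |B u v| ≤ K * ‖u‖ * ‖v‖ := by
    intro u v huv
    have h1 := hB (u + v)
    have h2 := hB (u - v)
    have h3 := parallelogram_law_with_norm ℝ u v
    -- Polarization combined with the parallelogram law loses no constant when `‖u‖ = ‖v‖`.
    have e : 4 * B u v = B (u + v) (u + v) - B (u - v) (u - v) := by
      simp only [map_add, map_sub, _root_.add_apply, _root_.sub_apply,
        hsymm v u]
      ring
    have e3 : K * ‖u + v‖ ^ 2 + K * ‖u - v‖ ^ 2 = 4 * (K * ‖u‖ * ‖v‖) := by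
      rw [huv] at h3 ⊢
      linear_combination K * h3
    rw [abs_le] at *
    constructor <;> linarith
  refine ContinuousLinearMap.opNorm_le_bound₂ _ hK fun u v => ?_
  by_cases hu : u = 0
  · simp [hu]
  by_cases hv : v = 0
  · simp [hv]
  have hun : 0 < ‖u‖ := norm_pos_iff.2 hu
  have hvn : 0 < ‖v‖ := norm_pos_iff.2 hv
  have h1 := key u ((‖u‖ / ‖v‖) • v) (by
    rw [norm_smul, Real.norm_eq_abs, abs_of_pos (by positivity), div_mul_cancel₀ _ hvn.ne'])
  rw [map_smul, smul_eq_mul, abs_mul, norm_smul, Real.norm_eq_abs,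
    abs_of_pos (by positivity : 0 < ‖u‖ / ‖v‖)] at h1
  refine le_of_mul_le_mul_left ?_ (by positivity : 0 < ‖u‖ / ‖v‖)
  rw [Real.norm_eq_abs]
  calc _ ≤ _ := h1
    _ = _ := by ring

lemma norm_fderiv_fderiv_le (hXo : IsOpen X) (hX : Convex ℝ X)
    (hw1 : LipschitzDeriv 1 L1 w X) (hw2 : LipschitzDeriv 2 L2 w X) (hL1 : 0 ≤ L1)
    (hL2 : 0 ≤ L2) {x : E n} (hx : x ∈ X) : ‖fderiv ℝ (fderiv ℝ w) x‖ ≤ L1 := by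
  refine ContinuousLinearMap.norm_le_of_abs_self_le (fun u v => ?_) hL1 fun u => ?_
  · simp only [fderiv_fderiv_apply hXo hX hw1 hw2 hL2 hx, polarHess_comm w x u v]
  · rw [fderiv_fderiv_apply hXo hX hw1 hw2 hL2 hx, polarHess_self]
    exact hw1.abs_lineDeriv2_le hx u

lemma eventually_norm_fderiv_fderiv_sub_le (hXo : IsOpen X) (hX : Convex ℝ X)
    (hw1 : LipschitzDeriv 1 L1 w X) (hw2 : LipschitzDeriv 2 L2 w X) (hL2 : 0 ≤ L2) {x : E n}
    (hx : x ∈ X) :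
    ∀ᶠ h in 𝓝 (0 : E n),
      ‖fderiv ℝ (fderiv ℝ w) (x + h) - fderiv ℝ (fderiv ℝ w) x‖ ≤ 8 * L2 * ‖h‖ := by
  filter_upwards [eventually_add_add_mem hXo hx] with h hh
  by_cases h0 : h = 0
  · rw [h0, add_zero, sub_self, norm_zero, mul_zero]
    exact (norm_zero (E := E n →L[ℝ] E n →L[ℝ] ℝ)).le
  have hn : 0 < ‖h‖ := norm_pos_iff.2 h0
  have hxh : x + h ∈ X := by simpa using hh 0 (by simp)
  have key : ∀ v : E n, ‖v‖ = ‖h‖ →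
      |lineDeriv2 w (x + h) v - lineDeriv2 w x v| ≤ 8 * L2 * ‖h‖ ^ 3 := by
    intro v hv
    have h1 := (abs_fderiv_sub_polarHess_le_aux hXo hX hw1 hw2 hL2 hx (h := h) (v := v)
      hxh (hh v hv.le)
      (by simpa [sub_eq_add_neg] using hh (-v) (by simp [hv]))).2
    -- The quadratic form at `x` satisfies the parallelogram identity because it is now known to
    -- come from a bilinear map. The symmetric estimate then compares the forms at `x` and `x + h`.
    have e : lineDeriv2 w x (h + v) + lineDeriv2 w x (h - v) =
        2 * lineDeriv2 w x h + 2 * lineDeriv2 w x v := by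
      simp only [← polarHess_self, ← hessMap_apply hXo hX hw1 hw2 hL2 hx, map_add, map_sub,
        _root_.add_apply, _root_.sub_apply]
      ring
    rw [hv, e] at h1
    rw [abs_sub_comm]
    calc _ = _ := by congr 1; ring
      _ ≤ _ := h1
      _ = _ := by ring
  refine ContinuousLinearMap.norm_le_of_abs_self_le (fun u v => ?_) (by positivity) fun v => ?_
  · simp only [_root_.sub_apply, fderiv_fderiv_apply hXo hX hw1 hw2 hL2 hx,
      fderiv_fderiv_apply hXo hX hw1 hw2 hL2 hxh, polarHess_comm w _ u v]
  · simp only [_root_.sub_apply, fderiv_fderiv_apply hXo hX hw1 hw2 hL2 hx,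
      fderiv_fderiv_apply hXo hX hw1 hw2 hL2 hxh, polarHess_self]
    by_cases hv0 : v = 0
    · subst hv0
      have : ∀ z : E n, lineDeriv2 w z 0 = 0 := fun z => by
        have := lineDeriv2_smul w z 0 0
        simpa using this
      simp [this]
    have hvn : 0 < ‖v‖ := norm_pos_iff.2 hv0
    have h1 := key ((‖h‖ / ‖v‖) • v) (by
      rw [norm_smul, Real.norm_eq_abs, abs_of_pos (by positivity), div_mul_cancel₀ _ hvn.ne'])
    rw [lineDeriv2_smul, lineDeriv2_smul, ← mul_sub, abs_mul, abs_of_pos (by positivity)] at h1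
    refine le_of_mul_le_mul_left ?_ (by positivity : 0 < (‖h‖ / ‖v‖) ^ 2)
    calc _ ≤ _ := h1
      _ = _ := by field_simp

/-- The local constant `8 * L2` becomes `9 * L2` only to leave the strict room required by the
comparison argument; absolute factors are harmless here. -/
lemma norm_fderiv_fderiv_sub_le (hXo : IsOpen X) (hX : Convex ℝ X)
    (hw1 : LipschitzDeriv 1 L1 w X) (hw2 : LipschitzDeriv 2 L2 w X) (hL2 : 0 < L2) {x h : E n}
    (hx : x ∈ X) (hxh : x + h ∈ X) :
    ‖fderiv ℝ (fderiv ℝ w) (x + h) - fderiv ℝ (fderiv ℝ w) x‖ ≤ 9 * L2 * ‖h‖ := by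
  by_cases h0 : h = 0
  · rw [h0, add_zero, sub_self, norm_zero, mul_zero]
    exact (norm_zero (E := E n →L[ℝ] E n →L[ℝ] ℝ)).le
  have hn : 0 < ‖h‖ := norm_pos_iff.2 h0
  have hseg : ∀ t ∈ Icc (0 : ℝ) 1, x + t • h ∈ X := fun t ht => hX.add_smul_mem hx hxh ht
  have hloc : ∀ t ∈ Icc (0 : ℝ) 1, ∀ᶠ s in 𝓝 t,
      ‖fderiv ℝ (fderiv ℝ w) (x + s • h) - fderiv ℝ (fderiv ℝ w) (x + t • h)‖ ≤
        8 * L2 * ‖h‖ * |s - t| := by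
    intro t ht
    have hc : Tendsto (fun s : ℝ => (s - t) • h) (𝓝 t) (𝓝 0) := by
      have : Continuous fun s : ℝ => (s - t) • h := by fun_prop
      simpa using this.tendsto t
    filter_upwards [hc.eventually
      (eventually_norm_fderiv_fderiv_sub_le hXo hX hw1 hw2 hL2.le (hseg t ht))] with s hs
    have e : x + t • h + (s - t) • h = x + s • h := by module
    rw [e, norm_smul, Real.norm_eq_abs] at hs
    calc _ ≤ _ := hs
      _ = _ := by ring
  have e := norm_sub_le_of_eventually_norm_sub_le (F := E n →L[ℝ] E n →L[ℝ] ℝ)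
    (G := fun t : ℝ => fderiv ℝ (fderiv ℝ w) (x + t • h)) (c' := 9 * L2 * ‖h‖)
    (by nlinarith [mul_pos hL2 hn]) hloc
  simp only [one_smul, zero_smul, add_zero] at e
  exact e

/-- The consequences of Lipschitz first and second derivatives that the analysis uses. -/
structure SmoothOn (w : E n → ℝ) (X : Set (E n)) (L1 L2 : ℝ) : Prop where
  diff : ∀ x ∈ X, DifferentiableAt ℝ w x
  diff2 : ∀ x ∈ X, DifferentiableAt ℝ (fderiv ℝ w) x
  hess_comm : ∀ x ∈ X, ∀ u v, fderiv ℝ (fderiv ℝ w) x u v = fderiv ℝ (fderiv ℝ w) x v u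
  value_one : ∀ x ∈ X, ∀ h, x + h ∈ X → |w (x + h) - w x - fderiv ℝ w x h| ≤ L1 / 2 * ‖h‖ ^ 2
  value_two : ∀ x ∈ X, ∀ h, x + h ∈ X →
    |w (x + h) - w x - fderiv ℝ w x h - 1 / 2 * hessForm w x h| ≤ L2 / 6 * ‖h‖ ^ 3
  grad_one : ∀ x ∈ X, ∀ h, x + h ∈ X → ‖fderiv ℝ w (x + h) - fderiv ℝ w x‖ ≤ L1 * ‖h‖
  grad_two : ∀ x ∈ X, ∀ h, x + h ∈ X →
    ‖fderiv ℝ w (x + h) - fderiv ℝ w x - fderiv ℝ (fderiv ℝ w) x h‖ ≤ 9 / 2 * L2 * ‖h‖ ^ 2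

lemma smoothOn_of_lipschitzDeriv (hXo : IsOpen X) (hX : Convex ℝ X)
    (hw1 : LipschitzDeriv 1 L1 w X) (hw2 : LipschitzDeriv 2 L2 w X) (hL1 : 0 ≤ L1)
    (hL2 : 0 < L2) : SmoothOn w X L1 L2 where
  diff x hx := hw1.differentiableAt hXo hX hx
  diff2 x hx := (hasFDerivAt_fderiv hXo hX hw1 hw2 hL2.le hx).differentiableAt
  hess_comm x hx u v := by
    simp only [fderiv_fderiv_apply hXo hX hw1 hw2 hL2.le hx, polarHess_comm w x u v]
  value_one x hx h hh := hw1.abs_sub_fderiv_le hXo hX hx hh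
  value_two x hx h hh := by
    rw [← (hw1.differentiableAt hXo hX hx).lineDeriv_eq_fderiv, hessForm_eq hXo hX hw1 hw2 hL2.le hx]
    exact hw2.abs_sub_lineDeriv2_le hX hx hh
  grad_one x hx h hh := by
    have := hX.norm_image_sub_le_of_norm_fderiv_le (f := fderiv ℝ w) (𝕜 := ℝ)
      (fun z hz => (hasFDerivAt_fderiv hXo hX hw1 hw2 hL2.le hz).differentiableAt)
      (fun z hz => norm_fderiv_fderiv_le hXo hX hw1 hw2 hL1 hL2.le hz) hx hh
    simpa using this
  grad_two x hx h hh := by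
    have hseg : ∀ t ∈ Icc (0 : ℝ) 1, x + t • h ∈ X := fun t ht => hX.add_smul_mem hx hh ht
    have := norm_le_of_norm_deriv_le_pow (T := 1) (C := 9 * L2 * ‖h‖ ^ 2)
      (h := fun t : ℝ => fderiv ℝ w (x + t • h) - fderiv ℝ w x
        - t • fderiv ℝ (fderiv ℝ w) x h)
      (h' := fun t => fderiv ℝ (fderiv ℝ w) (x + t • h) h - fderiv ℝ (fderiv ℝ w) x h) 1
      (fun t ht => by
        have h1 : HasDerivAt (fun t : ℝ => x + t • h) h t := by
          simpa using ((hasDerivAt_id t).smul_const h).const_add x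
        have h2 := (hasFDerivAt_fderiv hXo hX hw1 hw2 hL2.le
          (hseg t ht)).differentiableAt.hasFDerivAt.comp_hasDerivAt t h1
        have h3 := (hasDerivAt_id t).smul_const (fderiv ℝ (fderiv ℝ w) x h)
        rw [one_smul] at h3
        exact (h2.sub_const _).sub h3)
      (by simp)
      (fun t ht => by
        have h1 := norm_fderiv_fderiv_sub_le hXo hX hw1 hw2 hL2 hx (hseg t ht)
        rw [norm_smul, Real.norm_eq_abs, abs_of_nonneg ht.1] at h1
        rw [← _root_.sub_apply]
        calc _ ≤ _ := ContinuousLinearMap.le_of_opNorm_le _ h1 h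
          _ = _ := by ring) 1 (right_mem_Icc.2 zero_le_one)
    norm_num at this
    calc _ ≤ _ := this
      _ = _ := by ring

end Smooth

/-! ### Convex problems with smooth data -/

/-- A convex problem whose data are smooth on the strictly feasible set. -/
structure SmoothConvex (f : E n → ℝ) (a : Fin m → E n → ℝ) (L1 L2 : ℝ) : Prop where
  L1_pos : 0 < L1
  L2_pos : 0 < L2
  cont : ∀ i, Continuous (a i)
  isOpen : IsOpen (feasible a)
  convex : Convex ℝ (feasible a)
  obj : SmoothOn f (feasible a) L1 L2
  con : ∀ i, SmoothOn (a i) (feasible a) L1 L2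
  obj_convex : ConvexOn ℝ univ f
  con_concave : ∀ i, ConcaveOn ℝ univ (a i)

lemma isOpen_feasible {a : Fin m → E n → ℝ} (ha : ∀ i, Continuous (a i)) :
    IsOpen (feasible a) := by
  have : feasible a = ⋂ i, {x | 0 < a i x} := by ext; simp [feasible]
  rw [this]
  exact isOpen_iInter_of_finite fun i => isOpen_lt continuous_const (ha i)

lemma convex_feasible {a : Fin m → E n → ℝ} (ha : ∀ i, ConcaveOn ℝ univ (a i)) :
    Convex ℝ (feasible a) := by
  have : feasible a = ⋂ i, {x | x ∈ univ ∧ 0 < a i x} := by ext; simp [feasible]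
  rw [this]
  exact convex_iInter fun i => (ha i).convex_gt 0

lemma SmoothOn.value_one_neg {w : E n → ℝ} {X : Set (E n)} {L1 L2 : ℝ} (hw : SmoothOn w X L1 L2) :
    ∀ x ∈ X, ∀ h, x + h ∈ X → |(-w) (x + h) - (-w) x - fderiv ℝ (-w) x h| ≤ L1 / 2 * ‖h‖ ^ 2 := by
  intro x hx h hh
  have := hw.value_one x hx h hh
  rw [fderiv_neg, ← abs_neg]
  simp only [Pi.neg_apply, _root_.neg_apply]
  convert this using 2
  ring

/-- The gradient inequality. -/
lemma ConvexOn.add_fderiv_le {w : E n → ℝ} {X : Set (E n)} {C : ℝ} (hX : Convex ℝ X)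
    (hc : ConvexOn ℝ univ w)
    (hw : ∀ x ∈ X, ∀ h, x + h ∈ X → |w (x + h) - w x - fderiv ℝ w x h| ≤ C * ‖h‖ ^ 2)
    {x z : E n} (hx : x ∈ X) (hz : z ∈ X) : w x + fderiv ℝ w x (z - x) ≤ w z := by
  suffices w x + fderiv ℝ w x (z - x) - w z ≤ 0 by linarith
  refine nonpos_of_eventually_mul_le_sq (C := C * ‖z - x‖ ^ 2) ?_
  filter_upwards [self_mem_nhdsWithin, nhdsWithin_le_nhds (Iio_mem_nhds zero_lt_one)] with t h0 h1
  have h0 : 0 < t := h0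
  have h1 : t < 1 := h1
  have hm : x + t • (z - x) ∈ X :=
    hX.add_smul_mem hx (by simpa using hz) ⟨h0.le, h1.le⟩
  have e1 := (abs_le.1 (hw x hx _ hm)).1
  have e2 := hc.2 (mem_univ x) (mem_univ z) (sub_nonneg.2 h1.le) h0.le (by ring)
  have e3 : (1 - t) • x + t • z = x + t • (z - x) := by module
  rw [e3, smul_eq_mul, smul_eq_mul] at e2
  rw [map_smul, norm_smul, Real.norm_eq_abs, mul_pow, sq_abs, smul_eq_mul] at e1
  linarith

/-- The gradient inequality makes the quadratic term of the second-order expansion nonnegative up to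
a cubic error. -/
lemma SmoothOn.hessForm_nonneg {w : E n → ℝ} {X : Set (E n)} {L1 L2 : ℝ} (hXo : IsOpen X)
    (hX : Convex ℝ X) (hw : SmoothOn w X L1 L2) (hc : ConvexOn ℝ univ w) {x : E n} (hx : x ∈ X)
    (u : E n) : 0 ≤ hessForm w x u := by
  suffices -(1 / 2 * hessForm w x u) ≤ 0 by linarith
  refine nonpos_of_eventually_mul_le_sq (C := L2 / 6 * ‖u‖ ^ 3) ?_
  filter_upwards [self_mem_nhdsWithin, eventually_add_smul_mem hXo hx u] with t h0 hm
  have h0 : 0 < t := h0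
  have e1 := (abs_le.1 (hw.value_two x hx _ hm)).2
  have e2 := ConvexOn.add_fderiv_le hX hc hw.value_one hx hm
  rw [add_sub_cancel_left] at e2
  have e3 : hessForm w x (t • u) = t ^ 2 * hessForm w x u := by
    simp [hessForm, sq, mul_assoc]
  rw [e3, norm_smul, Real.norm_eq_abs, abs_of_pos h0] at e1
  refine le_of_mul_le_mul_left ?_ h0
  linarith

namespace SmoothConvex

variable {f : E n → ℝ} {a : Fin m → E n → ℝ} {L1 L2 : ℝ}

lemma obj_grad (P : SmoothConvex f a L1 L2) {x z : E n} (hx : x ∈ feasible a)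
    (hz : z ∈ feasible a) : f x + fderiv ℝ f x (z - x) ≤ f z :=
  ConvexOn.add_fderiv_le P.convex P.obj_convex P.obj.value_one hx hz

lemma con_grad (P : SmoothConvex f a L1 L2) (i : Fin m) {x z : E n} (hx : x ∈ feasible a)
    (hz : z ∈ feasible a) : a i z ≤ a i x + fderiv ℝ (a i) x (z - x) := by
  have := ConvexOn.add_fderiv_le P.convex (P.con_concave i).neg (P.con i).value_one_neg hx hz
  rw [fderiv_neg] at this
  simp only [Pi.neg_apply, _root_.neg_apply] at this
  linarith

lemma obj_hess (P : SmoothConvex f a L1 L2) {x : E n} (hx : x ∈ feasible a) (u : E n) :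
    0 ≤ hessForm f x u :=
  P.obj.hessForm_nonneg P.isOpen P.convex P.obj_convex hx u

lemma con_hess (P : SmoothConvex f a L1 L2) (i : Fin m) {x : E n} (hx : x ∈ feasible a)
    (u : E n) : hessForm (a i) x u ≤ 0 := by
  suffices 1 / 2 * hessForm (a i) x u ≤ 0 by linarith
  refine nonpos_of_eventually_mul_le_sq (C := L2 / 6 * ‖u‖ ^ 3) ?_
  filter_upwards [self_mem_nhdsWithin, eventually_add_smul_mem P.isOpen hx u] with t h0 hm
  have h0 : 0 < t := h0
  have e1 := (abs_le.1 ((P.con i).value_two x hx _ hm)).1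
  have e2 := P.con_grad i hx hm
  rw [add_sub_cancel_left] at e2
  have e3 : hessForm (a i) x (t • u) = t ^ 2 * hessForm (a i) x u := by
    simp [hessForm, sq, mul_assoc]
  rw [e3, norm_smul, Real.norm_eq_abs, abs_of_pos h0] at e1
  refine le_of_mul_le_mul_left ?_ h0
  linarith

/-! ### Derivatives of the barrier and of the Lagrangian -/

lemma hasFDerivAt_barrier (P : SmoothConvex f a L1 L2) (μ : ℝ) {x : E n} (hx : x ∈ feasible a) :
    HasFDerivAt (barrier f a μ)
      (fderiv ℝ f x - ∑ i, (μ * (a i x)⁻¹) • fderiv ℝ (a i) x) x := by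
  have h1 : HasFDerivAt (fun z => ∑ i, Real.log (a i z))
      (∑ i, (a i x)⁻¹ • fderiv ℝ (a i) x) x :=
    HasFDerivAt.fun_sum fun i _ => ((P.con i).diff x hx).hasFDerivAt.log (hx i).ne'
  refine ((P.obj.diff x hx).hasFDerivAt.sub (h1.const_mul μ)).congr_fderiv ?_
  simp only [Finset.smul_sum, smul_smul]

lemma hasFDerivAt_fderiv_barrier (P : SmoothConvex f a L1 L2) (μ : ℝ) {x : E n}
    (hx : x ∈ feasible a) :
    HasFDerivAt (fderiv ℝ (barrier f a μ))
      (fderiv ℝ (fderiv ℝ f) x - ∑ i, ((μ * (a i x)⁻¹) • fderiv ℝ (fderiv ℝ (a i)) x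
        + (μ • (-((a i x) ^ 2)⁻¹ • fderiv ℝ (a i) x)).smulRight (fderiv ℝ (a i) x))) x := by
  have h1 : HasFDerivAt (fun z => fderiv ℝ f z - ∑ i, (μ * (a i z)⁻¹) • fderiv ℝ (a i) z)
      (fderiv ℝ (fderiv ℝ f) x - ∑ i, ((μ * (a i x)⁻¹) • fderiv ℝ (fderiv ℝ (a i)) x
        + (μ • (-((a i x) ^ 2)⁻¹ • fderiv ℝ (a i) x)).smulRight (fderiv ℝ (a i) x))) x := by
    refine (P.obj.diff2 x hx).hasFDerivAt.sub (HasFDerivAt.fun_sum fun i _ => ?_)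
    refine HasFDerivAt.smul (c := fun z => μ * (a i z)⁻¹) ?_ ((P.con i).diff2 x hx).hasFDerivAt
    exact (((hasDerivAt_inv (hx i).ne').comp_hasFDerivAt x
      ((P.con i).diff x hx).hasFDerivAt).const_mul μ)
  refine h1.congr_of_eventuallyEq ?_
  filter_upwards [P.isOpen.mem_nhds hx] with z hz
  exact (P.hasFDerivAt_barrier μ hz).fderiv

lemma fderiv_barrier (P : SmoothConvex f a L1 L2) (μ : ℝ) {x : E n} (hx : x ∈ feasible a) :
    fderiv ℝ (barrier f a μ) x =
      fderiv ℝ f x - ∑ i, primalDual a μ x i • fderiv ℝ (a i) x := by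
  rw [(P.hasFDerivAt_barrier μ hx).fderiv]
  rfl

lemma fderiv_fderiv_barrier (P : SmoothConvex f a L1 L2) (μ : ℝ) {x : E n} (hx : x ∈ feasible a)
    (u : E n) :
    fderiv ℝ (fderiv ℝ (barrier f a μ)) x u = fderiv ℝ (fderiv ℝ f) x u -
      ∑ i, primalDual a μ x i • fderiv ℝ (fderiv ℝ (a i)) x u +
      ∑ i, (μ * slackDir a x u i / a i x ^ 2) • fderiv ℝ (a i) x := by
  rw [(P.hasFDerivAt_fderiv_barrier μ hx).fderiv]
  simp only [_root_.sub_apply, _root_.sum_apply, _root_.add_apply,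
    _root_.smul_apply, ContinuousLinearMap.smulRight_apply, Finset.sum_add_distrib]
  have : ∀ i, (μ • -(a i x ^ 2)⁻¹ • (fderiv ℝ (a i) x) u) • fderiv ℝ (a i) x =
      -((μ * slackDir a x u i / a i x ^ 2) • fderiv ℝ (a i) x) := by
    intro i
    rw [← neg_smul]
    congr 1
    simp only [slackDir, smul_eq_mul]
    ring
  simp only [this, Finset.sum_neg_distrib, primalDual, div_eq_mul_inv]
  abel

lemma hessForm_barrier (P : SmoothConvex f a L1 L2) (μ : ℝ) {x : E n} (hx : x ∈ feasible a)
    (u : E n) :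
    hessForm (barrier f a μ) x u = hessForm f x u -
      ∑ i, primalDual a μ x i * hessForm (a i) x u +
      μ * ∑ i, (slackDir a x u i / a i x) ^ 2 := by
  rw [hessForm, P.fderiv_fderiv_barrier μ hx]
  simp only [_root_.sub_apply, _root_.sum_apply, _root_.add_apply,
    _root_.smul_apply, Finset.mul_sum, hessForm, smul_eq_mul]
  congr 1
  refine Finset.sum_congr rfl fun i _ => ?_
  simp only [slackDir]
  ring

lemma fderiv_fderiv_barrier_comm (P : SmoothConvex f a L1 L2) (μ : ℝ) {x : E n}
    (hx : x ∈ feasible a) (u v : E n) :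
    fderiv ℝ (fderiv ℝ (barrier f a μ)) x u v = fderiv ℝ (fderiv ℝ (barrier f a μ)) x v u := by
  rw [P.fderiv_fderiv_barrier μ hx, P.fderiv_fderiv_barrier μ hx]
  simp only [_root_.sub_apply, _root_.sum_apply, _root_.add_apply,
    _root_.smul_apply, smul_eq_mul, P.obj.hess_comm x hx u v,
    fun i => (P.con i).hess_comm x hx u v]
  congr 1
  refine Finset.sum_congr rfl fun i _ => ?_
  simp only [slackDir]
  ring

lemma primalDual_pos {μ : ℝ} (hμ : 0 < μ) {x : E n} (hx : x ∈ feasible a) (i : Fin m) :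
    0 < primalDual a μ x i := div_pos hμ (hx i)

/-- Convexity of `f` and concavity of the constraints discard all curvature except the rank-one
barrier terms. This bound produces the decrease when a step is truncated. -/
lemma mul_sum_le_hessForm_barrier (P : SmoothConvex f a L1 L2) {μ : ℝ} (hμ : 0 < μ) {x : E n}
    (hx : x ∈ feasible a) (u : E n) :
    μ * ∑ i, (slackDir a x u i / a i x) ^ 2 ≤ hessForm (barrier f a μ) x u := by
  rw [P.hessForm_barrier μ hx]
  have h1 := P.obj_hess hx u
  have h2 : ∑ i, primalDual a μ x i * hessForm (a i) x u ≤ 0 :=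
    Finset.sum_nonpos fun i _ =>
      mul_nonpos_of_nonneg_of_nonpos (primalDual_pos hμ hx i).le (P.con_hess i hx u)
  linarith

lemma hessForm_barrier_nonneg (P : SmoothConvex f a L1 L2) {μ : ℝ} (hμ : 0 < μ) {x : E n}
    (hx : x ∈ feasible a) (u : E n) : 0 ≤ hessForm (barrier f a μ) x u :=
  le_trans (by positivity) (P.mul_sum_le_hessForm_barrier hμ hx u)

lemma fderiv_lagrangian (P : SmoothConvex f a L1 L2) {x : E n} (hx : x ∈ feasible a)
    (y : Fin m → ℝ) :
    fderiv ℝ (fun z => lagrangian f a z y) x = fderiv ℝ f x - ∑ i, y i • fderiv ℝ (a i) x := by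
  refine HasFDerivAt.fderiv ?_
  exact (P.obj.diff x hx).hasFDerivAt.sub
    (HasFDerivAt.fun_sum fun i _ => ((P.con i).diff x hx).hasFDerivAt.const_mul (y i))

lemma norm_gradient_lagrangian (P : SmoothConvex f a L1 L2) {x : E n} (hx : x ∈ feasible a)
    (y : Fin m → ℝ) : ‖gradient (fun z => lagrangian f a z y) x‖ =
      ‖fderiv ℝ f x - ∑ i, y i • fderiv ℝ (a i) x‖ := by
  rw [gradient, LinearIsometryEquiv.norm_map, P.fderiv_lagrangian hx]

/-! ### Trust region subproblems -/

lemma exists_isSolver (f : E n → ℝ) (a : Fin m → E n → ℝ) : ∃ sol : Solver n, IsSolver f a sol := by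
  have h : ∀ (μ : ℝ) (x : E n) (r : ℝ), ∃ d, 0 ≤ r → IsTrustRegionSolution f a μ x r d := by
    intro μ x r
    by_cases hr : 0 ≤ r
    · have hc : Continuous (model f a μ x) := by
        unfold model hessForm
        fun_prop
      obtain ⟨d, hd, hmin⟩ := (isCompact_closedBall (0 : E n) r).exists_isMinOn
        ⟨0, by simpa using hr⟩ hc.continuousOn
      refine ⟨d, fun _ => ⟨by simpa using hd, fun u hu => hmin (by simpa using hu)⟩⟩
    -- For a negative radius the ball is empty and nothing is required; `0` is a default value.
    · exact ⟨0, fun h => absurd h hr⟩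
  choose d hd using h
  exact ⟨fun _ _ μ x r => d μ x r, fun _ _ μ x r _ _ hr => hd μ x r hr⟩

lemma model_add (P : SmoothConvex f a L1 L2) (μ : ℝ) {x : E n} (hx : x ∈ feasible a)
    (d u : E n) :
    model f a μ x (d + u) = model f a μ x d +
      (fderiv ℝ (barrier f a μ) x + fderiv ℝ (fderiv ℝ (barrier f a μ)) x d) u +
      1 / 2 * hessForm (barrier f a μ) x u := by
  simp only [model, hessForm, map_add, _root_.add_apply, P.fderiv_fderiv_barrier_comm μ hx u d]
  ring

lemma model_smul (μ t : ℝ) (x d : E n) :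
    model f a μ x (t • d) = t ^ 2 / 2 * hessForm (barrier f a μ) x d +
      t * fderiv ℝ (barrier f a μ) x d := by
  simp only [model, hessForm, map_smul, _root_.smul_apply, smul_eq_mul]
  ring

/-- First-order optimality for a trust region subproblem. -/
lemma mul_norm_le_of_isTrustRegionSolution (P : SmoothConvex f a L1 L2) {μ r : ℝ} (hr : 0 < r)
    {x d : E n} (hx : x ∈ feasible a) (hd : IsTrustRegionSolution f a μ x r d) :
    r * ‖fderiv ℝ (barrier f a μ) x + fderiv ℝ (fderiv ℝ (barrier f a μ)) x d‖ ≤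
      -(fderiv ℝ (barrier f a μ) x + fderiv ℝ (fderiv ℝ (barrier f a μ)) x d) d := by
  set W := fderiv ℝ (barrier f a μ) x + fderiv ℝ (fderiv ℝ (barrier f a μ)) x d with hW
  -- `W` is the gradient of the model at `d`. Minimality along segments of the convex ball gives the
  -- variational inequality, and testing it with `u = ± r • v` for unit `v` recovers `r * ‖W‖`.
  have key : ∀ u : E n, ‖u‖ ≤ r → W d ≤ W u := by
    intro u hu
    suffices -W (u - d) ≤ 0 by rw [map_sub] at this; linarith
    refine nonpos_of_eventually_mul_le_sq (C := 1 / 2 * hessForm (barrier f a μ) x (u - d)) ?_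
    filter_upwards [self_mem_nhdsWithin, nhdsWithin_le_nhds (Iio_mem_nhds zero_lt_one)]
      with t h0 h1
    have h0 : 0 < t := h0
    have h1 : t < 1 := h1
    have hm : d + t • (u - d) ∈ Metric.closedBall (0 : E n) r :=
      (convex_closedBall (0 : E n) r).add_smul_mem (by simpa using hd.1)
        (by simpa using hu) ⟨h0.le, h1.le⟩
    have := hd.2 _ (by simpa using hm)
    rw [P.model_add μ hx, ← hW, map_smul, smul_eq_mul] at this
    have e3 : hessForm (barrier f a μ) x (t • (u - d)) =
        t ^ 2 * hessForm (barrier f a μ) x (u - d) := by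
      simp only [hessForm, map_smul, _root_.smul_apply, smul_eq_mul]
      ring
    rw [e3] at this
    linarith
  have h0 : 0 ≤ -W d := by
    have := key 0 (by simpa using hr.le)
    rw [map_zero] at this
    linarith
  have hb : ‖W‖ ≤ -W d / r := by
    refine ContinuousLinearMap.opNorm_le_of_unit_norm (by positivity) fun v hv => ?_
    have h1 := key (r • v) (by rw [norm_smul, hv, Real.norm_eq_abs, abs_of_pos hr, mul_one])
    have h2 := key ((-r) • v)
      (by rw [norm_smul, hv, Real.norm_eq_abs, abs_neg, abs_of_pos hr, mul_one])
    rw [map_smul, smul_eq_mul] at h1 h2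
    rw [Real.norm_eq_abs, abs_le, ← neg_div, div_le_iff₀ hr, le_div_iff₀ hr]
    constructor <;> linarith
  rw [le_div_iff₀ hr] at hb
  linarith

end SmoothConvex

/-! ### One step of the method -/

/-- Here `41 / 800 = 1 / 20 + 1 / 800` is the sum of the bounds on the linear slack change and on
its linearization error. -/
lemma neg_log_one_add_le {t κ : ℝ} (hκ : 0 < κ) (hκ1 : κ ≤ 1) (ht : |t| ≤ 41 / 800 * κ) :
    -Real.log (1 + t) ≤ -t + t ^ 2 / 2 + 3 / 50 * κ * t ^ 2 := by
  have h1 : |(-t)| < 1 := by rw [abs_neg]; linarith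
  have h := (abs_le.1 (Real.abs_log_sub_add_sum_range_le h1 2)).1
  norm_num [Finset.sum_range_succ] at h
  have h2 : |t| ^ 3 / (1 - |t|) ≤ 3 / 50 * κ * t ^ 2 := by
    rw [div_le_iff₀ (by linarith), pow_succ, sq_abs]
    have h3 : |t| ≤ 3 / 50 * κ * (1 - |t|) := by nlinarith [abs_nonneg t]
    nlinarith [sq_nonneg t]
  linarith

/-- An `ℓ²` bound on `s` and an `ℓ¹` bound on `e` suffice, so the error does not depend on the
number of constraints. -/
lemma sum_neg_log_one_add_le {ι : Type*} [Fintype ι] {s e : ι → ℝ} {κ : ℝ} (hκ : 0 < κ)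
    (hκ1 : κ ≤ 1) (hs : ∑ i, s i ^ 2 ≤ (κ / 20) ^ 2) (he : ∑ i, |e i| ≤ κ / 800) :
    ∑ i, -Real.log (1 + (s i + e i)) ≤
      -∑ i, s i - ∑ i, e i + (∑ i, s i ^ 2) / 2 + κ ^ 2 / 4000 := by
  have hsi : ∀ i, |s i| ≤ κ / 20 := fun i => abs_le_of_sq_le_sq
    ((Finset.single_le_sum (f := fun i => s i ^ 2) (fun _ _ => sq_nonneg _)
      (Finset.mem_univ i)).trans hs) (by positivity)
  have hei : ∀ i, |e i| ≤ κ / 800 := fun i =>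
    (Finset.single_le_sum (f := fun i => |e i|) (fun _ _ => abs_nonneg _)
      (Finset.mem_univ i)).trans he
  have hti : ∀ i, -Real.log (1 + (s i + e i)) ≤
      -s i - e i + (1 / 2 + 3 / 50 * κ) * (s i ^ 2 + 81 / 800 * κ * |e i|) := by
    intro i
    have h1 := neg_log_one_add_le hκ hκ1
      (((abs_add_le (s i) (e i)).trans (add_le_add (hsi i) (hei i))).trans (by linarith))
    -- The constant is `2 * (1 / 20) + 1 / 800`, from the cross term and from `e i ^ 2`.
    have h2 : (s i + e i) ^ 2 ≤ s i ^ 2 + 81 / 800 * κ * |e i| := by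
      have h3 : s i * e i ≤ κ / 20 * |e i| :=
        (le_abs_self _).trans (by rw [abs_mul]; gcongr; exact hsi i)
      have h4 : e i ^ 2 ≤ κ / 800 * |e i| := by
        rw [← sq_abs, sq]; gcongr; exact hei i
      linarith
    have h5 : 0 ≤ 1 / 2 + 3 / 50 * κ := by positivity
    nlinarith [mul_le_mul_of_nonneg_left h2 h5]
  refine (Finset.sum_le_sum fun i _ => hti i).trans ?_
  rw [Finset.sum_add_distrib, Finset.sum_sub_distrib, Finset.sum_neg_distrib, ← Finset.mul_sum,
    Finset.sum_add_distrib, ← Finset.mul_sum]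
  have h6 : κ * ∑ i, |e i| ≤ κ * (κ / 800) := by gcongr
  have h7 : 3 / 50 * κ * (∑ i, s i ^ 2) ≤ 3 / 50 * κ * (κ / 20) ^ 2 := by gcongr
  have h8 : 3 / 50 * κ * (81 / 800 * (κ * ∑ i, |e i|)) ≤
    3 / 50 * κ * (81 / 800 * (κ * (κ / 800))) := by gcongr
  have h9 : κ ^ 3 ≤ κ ^ 2 := pow_le_pow_of_le_one hκ.le hκ1 (by norm_num)
  nlinarith [sq_nonneg κ, pow_pos hκ 4, pow_le_pow_of_le_one hκ.le hκ1 (show 2 ≤ 4 by norm_num)]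

/-- The relations between the parameters at a point `x`, where `κ = (τ_l² μ / L₁)^{1/3}` and `r`
is the trust region radius. -/
structure Scale (a : Fin m → E n → ℝ) (L1 L2 μ κ τl r : ℝ) (x : E n) : Prop where
  mem : x ∈ feasible a
  mu_pos : 0 < μ
  kappa_pos : 0 < κ
  kappa_le : κ ≤ 1
  tau_pos : 0 < τl
  r_pos : 0 < r
  radius_sq : L1 * (1 + l1 (primalDual a μ x)) * r ^ 2 = κ * μ / 400
  tau_radius : τl * r * Real.sqrt (1 + l1 (primalDual a μ x)) = κ ^ 2 / 20
  curvature : L2 * κ ≤ L1 * τl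

/-- A step that is short in the Euclidean norm and relative to the slacks. -/
structure ShortStep (a : Fin m → E n → ℝ) (κ r : ℝ) (x h : E n) : Prop where
  norm_le : ‖h‖ ≤ r
  slack_le : ∑ i, (slackDir a x h i / a i x) ^ 2 ≤ (κ / 20) ^ 2

lemma l1_primalDual {a : Fin m → E n → ℝ} {μ : ℝ} (hμ : 0 < μ) {x : E n} (hx : x ∈ feasible a) :
    l1 (primalDual a μ x) = ∑ i, primalDual a μ x i :=
  Finset.sum_congr rfl fun i _ => abs_of_pos (div_pos hμ (hx i))

lemma l1_nonneg (y : Fin m → ℝ) : 0 ≤ l1 y := Finset.sum_nonneg fun _ _ => abs_nonneg _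

/-- The dual variables after the primal step `h`. -/
noncomputable def stepDual (a : Fin m → E n → ℝ) (μ : ℝ) (x h : E n) : Fin m → ℝ :=
  fun i => primalDual a μ x i * (1 - slackDir a x h i / a i x)

namespace SmoothConvex

variable {f : E n → ℝ} {a : Fin m → E n → ℝ} {L1 L2 μ κ τl r : ℝ} {x h : E n}

/-- First-exit argument: the expansion of `a i` is available only at feasible points. Before the
first exit time the slacks stay above `1 - 1 / 20 - 1 / 2 = 9 / 20` of their value at `x`, and by
continuity they do so at that time too, a contradiction. -/
lemma add_mem_feasible (P : SmoothConvex f a L1 L2) (hx : x ∈ feasible a)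
    (hs : ∀ i, |slackDir a x h i / a i x| ≤ 1 / 20) (hr : ∀ i, L1 / 2 * ‖h‖ ^ 2 ≤ a i x / 2) :
    x + h ∈ feasible a := by
  by_contra hn
  let T : Set ℝ := Icc 0 1 ∩ {t | x + t • h ∉ feasible a}
  have hcl : IsClosed T := by
    refine isClosed_Icc.inter ?_
    have hc : Continuous fun t : ℝ => x + t • h := by fun_prop
    exact (P.isOpen.preimage hc).isClosed_compl
  have hne : T.Nonempty := ⟨1, by simp, by simpa using hn⟩
  have hbd : BddBelow T := ⟨0, fun t ht => ht.1.1⟩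
  have hmem := hcl.csInf_mem hne hbd
  set t0 := sInf T
  have ht0 : 0 < t0 := by
    refine lt_of_le_of_ne hmem.1.1 fun h0 => hmem.2 ?_
    rw [← h0]
    simpa using hx
  refine hmem.2 fun i => ?_
  have hpos := hx i
  have hlow : 9 / 20 * a i x ≤ a i (x + t0 • h) := by
    have hc : Continuous fun t : ℝ => a i (x + t • h) := (P.cont i).comp (by fun_prop)
    have hct : Tendsto (fun t : ℝ => a i (x + t • h)) (𝓝[<] t0) (𝓝 (a i (x + t0 • h))) :=
      (hc.tendsto t0).mono_left nhdsWithin_le_nhds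
    refine ge_of_tendsto hct ?_
    filter_upwards [self_mem_nhdsWithin, nhdsWithin_le_nhds (Ioi_mem_nhds ht0)] with t h1 h2
    have h1 : t < t0 := h1
    have h2 : 0 < t := h2
    have ht1 : t ≤ 1 := h1.le.trans hmem.1.2
    have htm : x + t • h ∈ feasible a := by
      by_contra hcon
      exact (csInf_le hbd ⟨⟨h2.le, ht1⟩, hcon⟩).not_gt h1
    have e := (abs_le.1 ((P.con i).value_one x hx _ htm)).1
    rw [map_smul, norm_smul, Real.norm_eq_abs, abs_of_pos h2, smul_eq_mul] at e
    have e2 := (abs_le.1 (hs i)).1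
    rw [le_div_iff₀ hpos] at e2
    have e3 : t * (-(1 / 20) * a i x) ≤ t * slackDir a x h i :=
      mul_le_mul_of_nonneg_left e2 h2.le
    have e4 : L1 / 2 * (t * ‖h‖) ^ 2 ≤ a i x / 2 := by
      refine le_trans ?_ (hr i)
      have : 0 ≤ L1 / 2 := by linarith [P.L1_pos]
      gcongr
      exact mul_le_of_le_one_left (norm_nonneg h) ht1
    simp only [slackDir] at e3
    nlinarith
  linarith

lemma slack_abs_le (D : Scale a L1 L2 μ κ τl r x) (H : ShortStep a κ r x h) (i : Fin m) :
    |slackDir a x h i / a i x| ≤ κ / 20 :=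
  abs_le_of_sq_le_sq
    ((Finset.single_le_sum (f := fun i => (slackDir a x h i / a i x) ^ 2)
      (fun _ _ => sq_nonneg _) (Finset.mem_univ i)).trans H.slack_le)
    (by linarith [D.kappa_pos])

lemma norm_sq_le (H : ShortStep a κ r x h) : ‖h‖ ^ 2 ≤ r ^ 2 :=
  pow_le_pow_left₀ (norm_nonneg h) H.norm_le 2

/-- This is what the factor `1 + ‖y‖₁` in the radius is for: the linearization errors of all slacks,
weighted by `y`, are bounded together. -/
lemma sum_primalDual_mul_le (P : SmoothConvex f a L1 L2) (D : Scale a L1 L2 μ κ τl r x)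
    (H : ShortStep a κ r x h) :
    ∑ i, primalDual a μ x i * (L1 / 2 * ‖h‖ ^ 2) ≤ κ * μ / 800 := by
  rw [← Finset.sum_mul, ← l1_primalDual D.mu_pos D.mem]
  have h1 : l1 (primalDual a μ x) * (L1 / 2 * ‖h‖ ^ 2) ≤
      (1 + l1 (primalDual a μ x)) * (L1 / 2 * r ^ 2) := by
    have := l1_nonneg (primalDual a μ x)
    have := P.L1_pos
    have := norm_sq_le H
    gcongr
    linarith
  linarith [D.radius_sq]

lemma primalDual_mul_le (P : SmoothConvex f a L1 L2) (D : Scale a L1 L2 μ κ τl r x)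
    (H : ShortStep a κ r x h) (i : Fin m) :
    primalDual a μ x i * (L1 / 2 * ‖h‖ ^ 2) ≤ κ * μ / 800 :=
  (Finset.single_le_sum (f := fun i => primalDual a μ x i * (L1 / 2 * ‖h‖ ^ 2))
    (fun j _ => mul_nonneg (primalDual_pos D.mu_pos D.mem j).le
      (by have := P.L1_pos; positivity)) (Finset.mem_univ i)).trans
    (P.sum_primalDual_mul_le D H)

lemma primalDual_mul_self (D : Scale a L1 L2 μ κ τl r x) (i : Fin m) :
    primalDual a μ x i * a i x = μ := div_mul_cancel₀ _ (D.mem i).ne'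

lemma step_mem (P : SmoothConvex f a L1 L2) (D : Scale a L1 L2 μ κ τl r x)
    (H : ShortStep a κ r x h) : x + h ∈ feasible a := by
  refine P.add_mem_feasible D.mem
    (fun i => (slack_abs_le D H i).trans (by linarith [D.kappa_le])) fun i => ?_
  refine le_of_mul_le_mul_left ?_ (primalDual_pos D.mu_pos D.mem i)
  have h1 := P.primalDual_mul_le D H i
  have h2 := primalDual_mul_self D i
  have h3 : κ * μ ≤ 1 * μ := mul_le_mul_of_nonneg_right D.kappa_le D.mu_pos.le
  have := D.mu_pos
  linarith

/-- The relative linearization error of the `i`-th slack. -/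
noncomputable def slackErr (a : Fin m → E n → ℝ) (x h : E n) (i : Fin m) : ℝ :=
  (a i (x + h) - a i x - slackDir a x h i) / a i x

lemma add_slack (hx : x ∈ feasible a) (i : Fin m) :
    a i (x + h) = a i x * (1 + (slackDir a x h i / a i x + slackErr a x h i)) := by
  have := (hx i).ne'
  unfold slackErr
  field_simp
  ring

lemma slackErr_nonpos (P : SmoothConvex f a L1 L2) (hx : x ∈ feasible a)
    (hh : x + h ∈ feasible a) (i : Fin m) : slackErr a x h i ≤ 0 := by
  refine div_nonpos_of_nonpos_of_nonneg ?_ (hx i).le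
  have := P.con_grad i hx hh
  rw [add_sub_cancel_left] at this
  simp only [slackDir]
  linarith

lemma mul_slackErr (i : Fin m) :
    μ * slackErr a x h i = primalDual a μ x i * (a i (x + h) - a i x - slackDir a x h i) := by
  unfold slackErr primalDual
  ring

lemma abs_mul_slackErr_le (P : SmoothConvex f a L1 L2) (D : Scale a L1 L2 μ κ τl r x)
    (hh : x + h ∈ feasible a) (i : Fin m) :
    μ * |slackErr a x h i| ≤ primalDual a μ x i * (L1 / 2 * ‖h‖ ^ 2) := by
  have h1 : μ * |slackErr a x h i| = |μ * slackErr a x h i| := by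
    rw [abs_mul, abs_of_pos D.mu_pos]
  rw [h1, mul_slackErr, abs_mul, abs_of_pos (primalDual_pos D.mu_pos D.mem i)]
  exact mul_le_mul_of_nonneg_left ((P.con i).value_one x D.mem h hh)
    (primalDual_pos D.mu_pos D.mem i).le

lemma sum_abs_slackErr_le (P : SmoothConvex f a L1 L2) (D : Scale a L1 L2 μ κ τl r x)
    (H : ShortStep a κ r x h) : ∑ i, |slackErr a x h i| ≤ κ / 800 := by
  refine le_of_mul_le_mul_left ?_ D.mu_pos
  rw [Finset.mul_sum]
  refine (Finset.sum_le_sum fun i _ => P.abs_mul_slackErr_le D (P.step_mem D H) i).trans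
    ((P.sum_primalDual_mul_le D H).trans (le_of_eq (by ring)))

lemma slackErr_ge (P : SmoothConvex f a L1 L2) (D : Scale a L1 L2 μ κ τl r x)
    (H : ShortStep a κ r x h) (i : Fin m) : -(κ / 800) ≤ slackErr a x h i :=
  (abs_le.1 ((Finset.single_le_sum (f := fun i => |slackErr a x h i|) (fun _ _ => abs_nonneg _)
    (Finset.mem_univ i)).trans (P.sum_abs_slackErr_le D H))).1

/-! #### Complementarity after a step -/

lemma stepDual_mul (D : Scale a L1 L2 μ κ τl r x) (i : Fin m) :
    stepDual a μ x h i * a i (x + h) = μ * ((1 - slackDir a x h i / a i x) *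
      (1 + (slackDir a x h i / a i x + slackErr a x h i))) := by
  rw [add_slack D.mem i, stepDual]
  linear_combination ((1 - slackDir a x h i / a i x) *
      (1 + (slackDir a x h i / a i x + slackErr a x h i))) * primalDual_mul_self D i

lemma stepDual_pos (D : Scale a L1 L2 μ κ τl r x) (H : ShortStep a κ r x h) (i : Fin m) :
    0 < stepDual a μ x h i := by
  refine mul_pos (primalDual_pos D.mu_pos D.mem i) ?_
  have := (abs_le.1 (slack_abs_le D H i)).2
  linarith [D.kappa_le]

/-- With `s` the relative slack change and `e ≤ 0` its error (concavity), `(1 - s) * (1 + s + e) ≤ 1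
- s ^ 2 ≤ 1`. This is sharper than the two-sided complementarity test and yields the gap `2 * m * μ`
without an extra `τc` term. -/
lemma stepDual_mul_le (P : SmoothConvex f a L1 L2) (D : Scale a L1 L2 μ κ τl r x)
    (H : ShortStep a κ r x h) (i : Fin m) : stepDual a μ x h i * a i (x + h) ≤ μ := by
  rw [stepDual_mul D]
  refine mul_le_of_le_one_right D.mu_pos.le ?_
  have h1 := P.slackErr_nonpos D.mem (P.step_mem D H) i
  have h2 := (abs_le.1 (slack_abs_le D H i)).2
  have h3 : 0 ≤ 1 - slackDir a x h i / a i x := by linarith [D.kappa_le]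
  nlinarith [mul_nonpos_of_nonneg_of_nonpos h3 h1, sq_nonneg (slackDir a x h i / a i x)]

lemma le_stepDual_mul (P : SmoothConvex f a L1 L2) (D : Scale a L1 L2 μ κ τl r x)
    (H : ShortStep a κ r x h) (i : Fin m) :
    μ - κ * μ / 2 ≤ stepDual a μ x h i * a i (x + h) := by
  rw [stepDual_mul D]
  set s := slackDir a x h i / a i x with hs
  set e := slackErr a x h i with he
  have h1 : -(κ / 800) ≤ e := P.slackErr_ge D H i
  have h2 := abs_le.1 (slack_abs_le D H i)
  have h0 := D.kappa_pos
  have h4 := D.kappa_le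
  have h3 : 0 ≤ 1 - s := by linarith [h2.2]
  have h5 : (1 - s) * (-(κ / 800)) ≤ (1 - s) * e := mul_le_mul_of_nonneg_left h1 h3
  have h6 : s ^ 2 ≤ (κ / 20) ^ 2 := sq_le_sq' (by linarith [h2.1]) h2.2
  have h7 : κ ^ 2 ≤ κ := by nlinarith
  have h8 : 1 - κ / 2 ≤ (1 - s) * (1 + (s + e)) := by nlinarith [h2.1]
  nlinarith [D.mu_pos]

/-! #### Decrease of the barrier -/

/-- The logarithms are expanded in the relative slack changes. Their terms linear in the
linearization errors supply the Hessians of the constraints in the model; the rest is the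
logarithmic remainder `κ ^ 2 / 4000` and a cubic Taylor error. -/
lemma barrier_sub_le_model (P : SmoothConvex f a L1 L2) (D : Scale a L1 L2 μ κ τl r x)
    (H : ShortStep a κ r x h) :
    barrier f a μ (x + h) - barrier f a μ x ≤ model f a μ x h + μ * κ ^ 2 / 2000 := by
  have hμ := D.mu_pos
  have hh := P.step_mem D H
  have hlog : -(μ * ∑ i, Real.log (a i (x + h))) + μ * ∑ i, Real.log (a i x) =
      μ * ∑ i, -Real.log (1 + (slackDir a x h i / a i x + slackErr a x h i)) := by
    rw [← mul_neg, ← mul_add, ← Finset.sum_neg_distrib, ← Finset.sum_add_distrib]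
    congr 1
    refine Finset.sum_congr rfl fun i _ => ?_
    have h1 := hh i
    rw [add_slack D.mem i] at h1 ⊢
    have h2 := (pos_iff_pos_of_mul_pos h1).1 (D.mem i)
    rw [Real.log_mul (D.mem i).ne' h2.ne']
    ring
  have hsum := mul_le_mul_of_nonneg_left (sum_neg_log_one_add_le D.kappa_pos D.kappa_le
    H.slack_le (P.sum_abs_slackErr_le D H)) hμ.le
  have herr : -(μ * ∑ i, slackErr a x h i) ≤
      -(∑ i, primalDual a μ x i * (1 / 2 * hessForm (a i) x h)) +
        l1 (primalDual a μ x) * (L2 / 6 * ‖h‖ ^ 3) := by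
    rw [l1_primalDual hμ D.mem, Finset.mul_sum, Finset.sum_mul, ← Finset.sum_neg_distrib,
      ← Finset.sum_neg_distrib, ← Finset.sum_add_distrib]
    refine Finset.sum_le_sum fun i _ => ?_
    rw [mul_slackErr]
    have h1 := (abs_le.1 ((P.con i).value_two x D.mem h hh)).1
    have h2 := mul_le_mul_of_nonneg_left h1 (primalDual_pos hμ D.mem i).le
    simp only [slackDir]
    linarith
  have hf := (abs_le.1 (P.obj.value_two x D.mem h hh)).2
  -- Two powers of `r` are absorbed by `radius_sq`, then `curvature` trades `L2 * κ` for `L1 * τl`,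
  -- and `tau_radius` controls `τl * r`; `48000 = 6 * 400 * 20`.
  have hcub : (1 + l1 (primalDual a μ x)) * (L2 / 6 * ‖h‖ ^ 3) ≤ μ * κ ^ 2 / 48000 := by
    have hM : 0 ≤ l1 (primalDual a μ x) := l1_nonneg _
    have hr := D.r_pos
    have hL1 := P.L1_pos
    have hL2 := P.L2_pos
    have e1 : (1 + l1 (primalDual a μ x)) * (L2 / 6 * ‖h‖ ^ 3) ≤
        (1 + l1 (primalDual a μ x)) * (L2 / 6 * r ^ 3) := by
      gcongr
      exact H.norm_le
    refine e1.trans ?_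
    refine le_of_mul_le_mul_left ?_ hL1
    have e2 : L1 * ((1 + l1 (primalDual a μ x)) * (L2 / 6 * r ^ 3)) =
        (L2 * κ) * (r * μ) / 2400 := by
      linear_combination (L2 / 6 * r) * D.radius_sq
    have e3 : (L2 * κ) * (r * μ) ≤ (L1 * τl) * (r * μ) := by gcongr ?_ * _; exact D.curvature
    have e4 : τl * r ≤ κ ^ 2 / 20 := by
      rw [← D.tau_radius]
      refine le_mul_of_one_le_right (mul_pos D.tau_pos hr).le ?_
      rw [Real.one_le_sqrt]
      linarith
    have e5 : L1 * μ * (τl * r) ≤ L1 * μ * (κ ^ 2 / 20) := by gcongr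
    rw [e2]
    linarith
  have hmodel : model f a μ x h = fderiv ℝ f x h - ∑ i, primalDual a μ x i * slackDir a x h i +
      1 / 2 * hessForm f x h - ∑ i, primalDual a μ x i * (1 / 2 * hessForm (a i) x h) +
      μ * (∑ i, (slackDir a x h i / a i x) ^ 2) / 2 := by
    rw [model, P.hessForm_barrier μ D.mem, P.fderiv_barrier μ D.mem]
    simp only [_root_.sub_apply, _root_.sum_apply, _root_.smul_apply, smul_eq_mul, slackDir]
    have : ∑ i, primalDual a μ x i * (1 / 2 * hessForm (a i) x h) =
      1 / 2 * ∑ i, primalDual a μ x i * hessForm (a i) x h := by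
      rw [Finset.mul_sum]
      exact Finset.sum_congr rfl fun i _ => by ring
    rw [this]
    ring
  have hlin : μ * ∑ i, slackDir a x h i / a i x = ∑ i, primalDual a μ x i * slackDir a x h i := by
    rw [Finset.mul_sum]
    exact Finset.sum_congr rfl fun i _ => by simp only [primalDual]; ring
  rw [hmodel, ← hlin]
  unfold barrier
  have : 0 ≤ μ * κ ^ 2 := by positivity
  linarith

/-! #### The gradient of the Lagrangian after a step -/

/-- The dual step is the linearization of `μ / a i`, so the new Lagrangian gradient equals the
gradient of the model at `h` up to second-order gradient remainders and products of a slack change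
with a gradient change. -/
lemma norm_lagrangian_grad_le (P : SmoothConvex f a L1 L2) (D : Scale a L1 L2 μ κ τl r x)
    (H : ShortStep a κ r x h) :
    ‖fderiv ℝ f (x + h) - ∑ i, stepDual a μ x h i • fderiv ℝ (a i) (x + h)‖ ≤
      ‖fderiv ℝ (barrier f a μ) x + fderiv ℝ (fderiv ℝ (barrier f a μ)) x h‖ +
        τl * μ * Real.sqrt (1 + l1 (primalDual a μ x)) / 50 := by
  have hμ := D.mu_pos
  have hr := D.r_pos
  have hL1 := P.L1_pos
  have hL2 := P.L2_pos
  have hh := P.step_mem D H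
  have hy := fun i => primalDual_pos hμ D.mem i
  set y := primalDual a μ x with hydef
  set Q := fderiv ℝ f (x + h) - fderiv ℝ f x - fderiv ℝ (fderiv ℝ f) x h with hQ
  set q : Fin m → E n →L[ℝ] ℝ := fun i =>
    fderiv ℝ (a i) (x + h) - fderiv ℝ (a i) x - fderiv ℝ (fderiv ℝ (a i)) x h with hq
  set g : Fin m → E n →L[ℝ] ℝ := fun i => fderiv ℝ (a i) (x + h) - fderiv ℝ (a i) x with hg
  have hid : fderiv ℝ f (x + h) - ∑ i, stepDual a μ x h i • fderiv ℝ (a i) (x + h) =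
      (fderiv ℝ (barrier f a μ) x + fderiv ℝ (fderiv ℝ (barrier f a μ)) x h) +
      (Q - ∑ i, y i • q i + ∑ i, (y i * (slackDir a x h i / a i x)) • g i) := by
    rw [P.fderiv_barrier μ D.mem, P.fderiv_fderiv_barrier μ D.mem, ← hydef, hQ]
    have e : ∀ i, stepDual a μ x h i • fderiv ℝ (a i) (x + h) =
        y i • fderiv ℝ (a i) x + y i • fderiv ℝ (fderiv ℝ (a i)) x h -
          (μ * slackDir a x h i / a i x ^ 2) • fderiv ℝ (a i) x + y i • q i -
          (y i * (slackDir a x h i / a i x)) • g i := by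
      intro i
      have e0 : μ * slackDir a x h i / a i x ^ 2 = y i * (slackDir a x h i / a i x) := by
        simp only [hydef, primalDual]; ring
      rw [e0]
      simp only [stepDual, hq, hg, ← hydef]
      module
    simp only [e, Finset.sum_add_distrib, Finset.sum_sub_distrib]
    abel
  have hQn : ‖Q‖ ≤ 9 / 2 * L2 * r ^ 2 :=
    (P.obj.grad_two x D.mem h hh).trans (by gcongr; exact H.norm_le)
  have hqn : ∀ i, ‖q i‖ ≤ 9 / 2 * L2 * r ^ 2 := fun i =>
    ((P.con i).grad_two x D.mem h hh).trans (by gcongr; exact H.norm_le)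
  have hgn : ∀ i, ‖g i‖ ≤ L1 * r := fun i =>
    ((P.con i).grad_one x D.mem h hh).trans (by gcongr; exact H.norm_le)
  have hs1 : ‖∑ i, y i • q i‖ ≤ l1 y * (9 / 2 * L2 * r ^ 2) := by
    rw [l1_primalDual hμ D.mem, Finset.sum_mul]
    refine norm_sum_le_of_le _ fun i _ => ?_
    rw [norm_smul, Real.norm_eq_abs, abs_of_pos (hy i)]
    exact mul_le_mul_of_nonneg_left (hqn i) (hy i).le
  have hs2 : ‖∑ i, (y i * (slackDir a x h i / a i x)) • g i‖ ≤ l1 y * (κ / 20 * (L1 * r)) := by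
    rw [l1_primalDual hμ D.mem, Finset.sum_mul]
    refine norm_sum_le_of_le _ fun i _ => ?_
    rw [norm_smul, Real.norm_eq_abs, abs_mul, abs_of_pos (hy i), mul_assoc]
    have := slack_abs_le D H i
    have := hy i
    have := D.kappa_pos
    have := hgn i
    gcongr
  have hM := l1_nonneg y
  have hsqrt : 1 ≤ Real.sqrt (1 + l1 y) := by rw [Real.one_le_sqrt]; linarith
  have hτ := D.tau_pos
  -- The two error groups contribute `9 / 800` and `1 / 400`, together below `1 / 50`.
  have b1 : (1 + l1 y) * (9 / 2 * L2 * r ^ 2) ≤ 9 / 800 * (τl * μ * Real.sqrt (1 + l1 y)) := by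
    have c1 : (1 + l1 y) * (9 / 2 * L2 * r ^ 2) ≤ 9 / 800 * (τl * μ) := by
      refine le_of_mul_le_mul_left ?_ hL1
      have e2 : L1 * ((1 + l1 y) * (9 / 2 * L2 * r ^ 2)) = 9 / 800 * ((L2 * κ) * μ) := by
        linear_combination (9 / 2 * L2) * D.radius_sq
      have e3 : (L2 * κ) * μ ≤ (L1 * τl) * μ := by gcongr ?_ * _; exact D.curvature
      rw [e2]
      linarith
    have c2 : τl * μ ≤ τl * μ * Real.sqrt (1 + l1 y) :=
      le_mul_of_one_le_right (by positivity) hsqrt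
    linarith
  have b2 : (1 + l1 y) * (κ / 20 * (L1 * r)) = 1 / 400 * (τl * μ * Real.sqrt (1 + l1 y)) := by
    refine mul_left_cancel₀ hr.ne' ?_
    linear_combination (κ / 20) * D.radius_sq - μ / 400 * D.tau_radius
  have b3 : l1 y * (κ / 20 * (L1 * r)) ≤ (1 + l1 y) * (κ / 20 * (L1 * r)) := by
    have := D.kappa_pos
    gcongr
    linarith
  have b4 : 0 < τl * μ * Real.sqrt (1 + l1 y) := by positivity
  rw [hid]
  refine (norm_add_le _ _).trans ?_
  gcongr
  refine (norm_add_le _ _).trans ?_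
  have := norm_sub_le Q (∑ i, y i • q i)
  linarith

end SmoothConvex

namespace SmoothConvex

variable {f : E n → ℝ} {a : Fin m → E n → ℝ} {L1 L2 μ κ τl r : ℝ} {x d : E n}

/-! ### One iteration of Trust-IPM -/

lemma tauC_pos (hL1 : 0 < L1) (hτ : 0 < τl) (hμ : 0 < μ) : 0 < tauC L1 τl μ :=
  Real.rpow_pos_of_pos (by positivity) _

lemma tauC_cube (hL1 : 0 < L1) (hτ : 0 < τl) (hμ : 0 < μ) :
    tauC L1 τl μ ^ 3 = τl ^ 2 * μ / L1 := by
  rw [tauC, ← Real.rpow_natCast, ← Real.rpow_mul (by positivity)]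
  norm_num

lemma etaX_sq (hL1 : 0 < L1) (hτ : 0 < τl) (hμ : 0 < μ) :
    (convexParams L1 τl μ).ηx ^ 2 = tauC L1 τl μ / 400 := by
  have : ((τl ^ 2 * μ / L1) ^ (1 / 6 : ℝ)) ^ 2 = tauC L1 τl μ := by
    rw [tauC, ← Real.rpow_natCast, ← Real.rpow_mul (by positivity)]
    norm_num
  rw [convexParams, mul_pow, this]
  ring

/-- The hypotheses `h1` and `h2` are what the two terms of `muInit` guarantee: the first gives `κ ≤
1`, the second gives `L2 * κ ≤ L1 * τl` after taking cubes. -/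
lemma scale_convexParams (P : SmoothConvex f a L1 L2) (hτ : 0 < τl) (hμ : 0 < μ)
    (h1 : τl ^ 2 * μ ≤ L1) (h2 : L2 ^ 3 * μ ≤ L1 ^ 4 * τl) (hx : x ∈ feasible a) :
    Scale a L1 L2 μ (tauC L1 τl μ) τl (radius a (convexParams L1 τl μ) x) x := by
  have hL1 := P.L1_pos
  have hL2 := P.L2_pos
  have hκ := tauC_pos hL1 hτ hμ
  have hκ3 := tauC_cube hL1 hτ hμ
  have hη := etaX_sq hL1 hτ hμ
  have hM : 0 < 1 + l1 (primalDual a μ x) := by linarith [l1_nonneg (primalDual a μ x)]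
  have hηp : 0 < (convexParams L1 τl μ).ηx := by
    unfold convexParams
    have : 0 < (τl ^ 2 * μ / L1) ^ (1 / 6 : ℝ) := Real.rpow_pos_of_pos (by positivity) _
    positivity
  have hr : 0 < radius a (convexParams L1 τl μ) x :=
    mul_pos hηp (Real.sqrt_pos.2 (div_pos hμ (mul_pos hL1 hM)))
  have hr2 : radius a (convexParams L1 τl μ) x ^ 2 =
      tauC L1 τl μ / 400 * (μ / (L1 * (1 + l1 (primalDual a μ x)))) := by
    rw [radius, mul_pow, hη, Real.sq_sqrt]
    · rfl
    · exact (div_pos hμ (mul_pos hL1 hM)).le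
  have hr2' : L1 * (1 + l1 (primalDual a μ x)) * radius a (convexParams L1 τl μ) x ^ 2 =
      tauC L1 τl μ * μ / 400 := by
    rw [hr2]
    field_simp
  refine ⟨hx, hμ, hκ, ?_, hτ, hr, hr2', ?_, ?_⟩
  · exact Real.rpow_le_one (by positivity) ((div_le_one hL1).2 h1) (by norm_num)
  · rw [← sq_eq_sq₀ (by positivity) (by positivity), mul_pow, mul_pow, Real.sq_sqrt hM.le]
    refine mul_left_cancel₀ hL1.ne' ?_
    rw [eq_div_iff hL1.ne'] at hκ3
    linear_combination τl ^ 2 * hr2' - tauC L1 τl μ / 400 * hκ3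
  · refine le_of_pow_le_pow_left₀ (n := 3) (by norm_num) (by positivity) ?_
    rw [mul_pow, mul_pow, hκ3, ← mul_div_assoc, div_le_iff₀ hL1]
    calc L2 ^ 3 * (τl ^ 2 * μ) = τl ^ 2 * (L2 ^ 3 * μ) := by ring
      _ ≤ τl ^ 2 * (L1 ^ 4 * τl) := by gcongr
      _ = _ := by ring

lemma slackDir_smul (t : ℝ) (x d : E n) (i : Fin m) :
    slackDir a x (t • d) i = t * slackDir a x d i := by
  simp [slackDir]

lemma relSlackNorm_sq (x d : E n) :
    relSlackNorm a x d ^ 2 = ∑ i, (slackDir a x d i / a i x) ^ 2 :=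
  Real.sq_sqrt (Finset.sum_nonneg fun _ _ => sq_nonneg _)

lemma relSlackNorm_nonneg (x d : E n) : 0 ≤ relSlackNorm a x d := Real.sqrt_nonneg _

lemma stepSize_nonneg {η : ℝ} (hη : 0 ≤ η) (x d : E n) : 0 ≤ stepSize a η x d := by
  unfold stepSize
  split_ifs
  · exact zero_le_one
  · exact le_min (div_nonneg hη (relSlackNorm_nonneg x d)) zero_le_one

lemma stepSize_le_one (η : ℝ) (x d : E n) : stepSize a η x d ≤ 1 := by
  unfold stepSize
  split_ifs
  · exact le_rfl
  · exact min_le_right _ _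

lemma stepSize_mul_le {η : ℝ} (hη : 0 ≤ η) (x d : E n) :
    stepSize a η x d * relSlackNorm a x d ≤ η := by
  unfold stepSize
  split_ifs with h
  · rw [h]; simpa using hη
  · have hp : 0 < relSlackNorm a x d := lt_of_le_of_ne (relSlackNorm_nonneg x d) (Ne.symm h)
    rw [← le_div_iff₀ hp]
    exact min_le_left _ _

lemma stepSize_mul_eq {η : ℝ} {x d : E n} (h1 : stepSize a η x d ≠ 1) :
    stepSize a η x d * relSlackNorm a x d = η := by
  unfold stepSize at *
  split_ifs with h
  · exact absurd (if_pos h) h1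
  · rw [if_neg h] at h1
    rcases min_choice (η / relSlackNorm a x d) 1 with h2 | h2
    · rw [h2, div_mul_cancel₀ _ h]
    · exact absurd h2 h1

lemma shortStep_smul (D : Scale a L1 L2 μ κ τl r x) (hd : ‖d‖ ≤ r) :
    ShortStep a κ r x (stepSize a (κ / 20) x d • d) := by
  have hη : 0 ≤ κ / 20 := by linarith [D.kappa_pos]
  refine ⟨?_, ?_⟩
  · rw [norm_smul, Real.norm_eq_abs, abs_of_nonneg (stepSize_nonneg hη x d)]
    exact (mul_le_of_le_one_left (norm_nonneg d) (stepSize_le_one _ x d)).trans hd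
  · have e : ∑ i, (slackDir a x (stepSize a (κ / 20) x d • d) i / a i x) ^ 2 =
        (stepSize a (κ / 20) x d * relSlackNorm a x d) ^ 2 := by
      rw [mul_pow, relSlackNorm_sq, Finset.mul_sum]
      refine Finset.sum_congr rfl fun i _ => ?_
      rw [slackDir_smul]
      ring
    rw [e]
    exact pow_le_pow_left₀ (mul_nonneg (stepSize_nonneg hη x d) (relSlackNorm_nonneg x d))
      (stepSize_mul_le hη x d) 2

/-- The model decrease when the step is truncated. -/
lemma model_truncated_le (P : SmoothConvex f a L1 L2) (D : Scale a L1 L2 μ κ τl r x)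
    (hd : IsTrustRegionSolution f a μ x r d) (h1 : stepSize a (κ / 20) x d ≠ 1) :
    model f a μ x (stepSize a (κ / 20) x d • d) ≤ -(μ * κ ^ 2 / 800) := by
  have hμ := D.mu_pos
  have hη : 0 ≤ κ / 20 := by linarith [D.kappa_pos]
  have hopt := P.mul_norm_le_of_isTrustRegionSolution D.r_pos D.mem hd
  have hW : (fderiv ℝ (barrier f a μ) x + fderiv ℝ (fderiv ℝ (barrier f a μ)) x d) d =
      fderiv ℝ (barrier f a μ) x d + hessForm (barrier f a μ) x d := rfl
  have h0 : fderiv ℝ (barrier f a μ) x d + hessForm (barrier f a μ) x d ≤ 0 := by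
    rw [← hW]
    have := mul_nonneg D.r_pos.le (norm_nonneg
      (fderiv ℝ (barrier f a μ) x + fderiv ℝ (fderiv ℝ (barrier f a μ)) x d))
    linarith
  have hH := P.mul_sum_le_hessForm_barrier hμ D.mem d
  rw [← relSlackNorm_sq] at hH
  have hα0 := stepSize_nonneg (a := a) hη x d
  have hα1 := stepSize_le_one (a := a) (κ / 20) x d
  have hασ := stepSize_mul_eq h1
  set α := stepSize a (κ / 20) x d
  set σ := relSlackNorm a x d
  set H := hessForm (barrier f a μ) x d
  rw [model_smul]
  have hH0 : 0 ≤ H := P.hessForm_barrier_nonneg hμ D.mem d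
  -- Optimality bounds the slope by `-H`, so the model at `α • d` is at most `α ^ 2 * H / 2 - α * H
  -- ≤ -(α ^ 2 * H / 2)`. Truncation means `α * σ = κ / 20`, and `H ≥ μ * σ ^ 2`.
  have e1 : α * fderiv ℝ (barrier f a μ) x d ≤ α * -H :=
    mul_le_mul_of_nonneg_left (by linarith) hα0
  have e2 : α ^ 2 * (μ * σ ^ 2) ≤ α ^ 2 * H := mul_le_mul_of_nonneg_left hH (sq_nonneg α)
  have e3 : α ^ 2 * (μ * σ ^ 2) = μ * (κ / 20) ^ 2 := by rw [← hασ]; ring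
  have e4 : α ^ 2 * H ≤ α * H := by
    refine mul_le_mul_of_nonneg_right ?_ hH0
    nlinarith
  linarith

/-- The model at `d` is its directional derivative `W d` at `d` minus half the nonnegative
curvature, and optimality gives `W d ≤ -r * ‖W‖`. -/
lemma model_full_le (P : SmoothConvex f a L1 L2) (D : Scale a L1 L2 μ κ τl r x)
    (hd : IsTrustRegionSolution f a μ x r d) :
    model f a μ x d ≤
      -(r * ‖fderiv ℝ (barrier f a μ) x + fderiv ℝ (fderiv ℝ (barrier f a μ)) x d‖) := by
  have hopt := P.mul_norm_le_of_isTrustRegionSolution D.r_pos D.mem hd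
  have hW : (fderiv ℝ (barrier f a μ) x + fderiv ℝ (fderiv ℝ (barrier f a μ)) x d) d =
      fderiv ℝ (barrier f a μ) x d + hessForm (barrier f a μ) x d := rfl
  have hH0 := P.hessForm_barrier_nonneg D.mu_pos D.mem d
  rw [hW] at hopt
  rw [model]
  linarith

lemma sqrt_stepDual_ge (D : Scale a L1 L2 μ κ τl r x) {h : E n} (H : ShortStep a κ r x h) :
    19 / 20 * Real.sqrt (1 + l1 (primalDual a μ x)) ≤ Real.sqrt (l1 (stepDual a μ x h) + 1) := by
  have hM := l1_nonneg (primalDual a μ x)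
  have h1 : 19 / 20 * l1 (primalDual a μ x) ≤ l1 (stepDual a μ x h) := by
    rw [l1_primalDual D.mu_pos D.mem, Finset.mul_sum]
    refine Finset.sum_le_sum fun i _ => ?_
    rw [abs_of_pos (stepDual_pos D H i), stepDual, mul_comm]
    have := (abs_le.1 (slack_abs_le D H i)).2
    exact mul_le_mul_of_nonneg_left (by linarith [D.kappa_le])
      (primalDual_pos D.mu_pos D.mem i).le
  refine Real.le_sqrt_of_sq_le ?_
  rw [mul_pow, Real.sq_sqrt (by linarith)]
  linarith

/-- An iteration that does not reach an approximate Fritz John point decreases the barrier. -/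
lemma iteration (P : SmoothConvex f a L1 L2) (D : Scale a L1 L2 μ κ τl r x)
    (hd : IsTrustRegionSolution f a μ x r d)
    (hF : ¬ FJ1 f a μ τl κ (x + stepSize a (κ / 20) x d • d)
      (stepDual a μ x (stepSize a (κ / 20) x d • d))) :
    barrier f a μ (x + stepSize a (κ / 20) x d • d) ≤ barrier f a μ x - μ * κ ^ 2 / 2000 := by
  have H := shortStep_smul D hd.1
  have hdec := P.barrier_sub_le_model D H
  have hμκ : 0 < μ * κ ^ 2 := mul_pos D.mu_pos (pow_pos D.kappa_pos 2)
  by_cases h1 : stepSize a (κ / 20) x d = 1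
  · rw [h1, one_smul] at H hdec hF ⊢
    have hg : τl * μ * Real.sqrt (l1 (stepDual a μ x d) + 1) <
        ‖fderiv ℝ f (x + d) - ∑ i, stepDual a μ x d i • fderiv ℝ (a i) (x + d)‖ := by
      by_contra hcon
      refine hF ⟨P.step_mem D H, stepDual_pos D H, fun i => ?_, ?_⟩
      · have e1 := P.stepDual_mul_le D H i
        have e2 := P.le_stepDual_mul D H i
        have e3 := mul_pos D.kappa_pos D.mu_pos
        rw [abs_le]
        constructor <;> linarith
      · rw [P.norm_gradient_lagrangian (P.step_mem D H)]
        exact not_lt.1 hcon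
    have hgrad := P.norm_lagrangian_grad_le D H
    have hfull := P.model_full_le D hd
    have hsq := sqrt_stepDual_ge D H
    have hτμ : 0 < τl * μ := mul_pos D.tau_pos D.mu_pos
    have e1 : τl * μ * (19 / 20 * Real.sqrt (1 + l1 (primalDual a μ x))) ≤
        τl * μ * Real.sqrt (l1 (stepDual a μ x d) + 1) := by gcongr
    -- `93 / 100 = 19 / 20 - 1 / 50`: the violated gradient test minus the error in passing to the
    -- gradient of the model.
    have e2 : τl * μ * Real.sqrt (1 + l1 (primalDual a μ x)) * (93 / 100) ≤
        ‖fderiv ℝ (barrier f a μ) x + fderiv ℝ (fderiv ℝ (barrier f a μ)) x d‖ := by linarith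
    have e3 := mul_le_mul_of_nonneg_left e2 D.r_pos.le
    have e4 : r * (τl * μ * Real.sqrt (1 + l1 (primalDual a μ x)) * (93 / 100)) =
        93 / 2000 * (μ * κ ^ 2) := by
      linear_combination (93 / 100 * μ) * D.tau_radius
    linarith
  · have := P.model_truncated_le D hd h1
    linarith

/-! ### Trust-IPM -/

lemma nextDual_eq (p : Params) (x d : E n) :
    nextDual a p x d = stepDual a p.μ x (stepSize a p.ηs x d • d) := by
  funext i
  simp only [nextDual, stepDual, slackDir_smul, primalDual]
  ring

lemma convexParams_etaS : (convexParams L1 τl μ).ηs = tauC L1 τl μ / 20 := by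
  simp only [convexParams, tauC]
  ring

/-- Trust-IPM with the parameters of the convex case returns, and its number of iterations is
controlled by the initial suboptimality `Δ` of the barrier. -/
lemma exists_trustIPMReturns (P : SmoothConvex f a L1 L2) (hτ : 0 < τl) (hμ : 0 < μ)
    (h1 : τl ^ 2 * μ ≤ L1) (h2 : L2 ^ 3 * μ ≤ L1 ^ 4 * τl) {x0 : E n} (hx0 : x0 ∈ feasible a)
    {Δ : ℝ} (hΔ : ∀ z ∈ feasible a, barrier f a μ x0 - barrier f a μ z ≤ Δ)
    {sol : ℕ → E n → ℝ → E n}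
    (hsol : ∀ k, ∀ x ∈ feasible a, ∀ r, 0 ≤ r → IsTrustRegionSolution f a μ x r (sol k x r)) :
    ∃ (N : ℕ) (x : E n) (y : Fin m → ℝ),
      TrustIPMReturns f a (convexParams L1 τl μ) sol x0 N x y ∧
      (N : ℝ) ≤ 1 + 2000 * (Δ / (μ * tauC L1 τl μ ^ 2)) ∧
      FJ1 f a μ τl (tauC L1 τl μ) x y ∧
      (∀ i, y i * a i x ≤ μ) ∧ ∀ i, μ / 2 ≤ y i * a i x := by
  set p := convexParams L1 τl μ with hp
  set κ := tauC L1 τl μ with hκ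
  have hκ0 : 0 < κ := tauC_pos P.L1_pos hτ hμ
  have hsc : ∀ x ∈ feasible a, Scale a L1 L2 μ κ τl (radius a p x) x := fun x hx =>
    P.scale_convexParams hτ hμ h1 h2 hx
  have hηs : p.ηs = κ / 20 := convexParams_etaS
  have hprim : ∀ k, trustPrimal a p sol x0 k = trustIterate a p sol x0 k +
      stepSize a (κ / 20) (trustIterate a p sol x0 k) (trustDir a p sol x0 k) •
        trustDir a p sol x0 k := fun k => by rw [trustPrimal, nextPrimal, hηs]
  have hdual : ∀ k, trustDual a p sol x0 k = stepDual a μ (trustIterate a p sol x0 k)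
      (stepSize a (κ / 20) (trustIterate a p sol x0 k) (trustDir a p sol x0 k) •
        trustDir a p sol x0 k) := fun k => by rw [trustDual, nextDual_eq, hηs]; rfl
  have hdir : ∀ k, trustIterate a p sol x0 k ∈ feasible a →
      IsTrustRegionSolution f a μ (trustIterate a p sol x0 k)
        (radius a p (trustIterate a p sol x0 k)) (trustDir a p sol x0 k) := fun k hk =>
    hsol k _ hk _ (hsc _ hk).r_pos.le
  have hmem : ∀ k, trustIterate a p sol x0 k ∈ feasible a := by
    intro k
    induction k with
    | zero => exact hx0
    | succ k ih =>
      have : trustIterate a p sol x0 (k + 1) = trustPrimal a p sol x0 k := rfl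
      rw [this, hprim]
      exact P.step_mem (hsc _ ih) (shortStep_smul (hsc _ ih) (hdir k ih).1)
  have hstep : ∀ k, ShortStep a κ (radius a p (trustIterate a p sol x0 k))
      (trustIterate a p sol x0 k)
      (stepSize a (κ / 20) (trustIterate a p sol x0 k) (trustDir a p sol x0 k) •
        trustDir a p sol x0 k) := fun k =>
    shortStep_smul (hsc _ (hmem k)) (hdir k (hmem k)).1
  have hdec : ∀ k, ¬ trustTest f a p sol x0 k →
      barrier f a μ (trustIterate a p sol x0 (k + 1)) ≤
        barrier f a μ (trustIterate a p sol x0 k) - μ * κ ^ 2 / 2000 := by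
    intro k hk
    have hit : trustIterate a p sol x0 (k + 1) = trustPrimal a p sol x0 k := rfl
    rw [hit, hprim]
    -- A failed test means a failed first-order test, since convexity of the barrier makes the
    -- second-order condition automatic.
    refine P.iteration (hsc _ (hmem k)) (hdir k (hmem k)) fun hF => hk ⟨?_, fun u => ?_⟩
    · rw [hprim, hdual]
      exact hF
    · refine le_trans ?_ (P.hessForm_barrier_nonneg hμ (hit ▸ hmem (k + 1)) u)
      have := l1_nonneg (trustDual a p sol x0 k)
      have : 0 ≤ Real.sqrt p.τl * (1 + l1 (trustDual a p sol x0 k)) * ‖u‖ ^ 2 := by positivity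
      linarith
  have hc : 0 < μ * κ ^ 2 := by positivity
  set K := ⌊2000 * (Δ / (μ * κ ^ 2))⌋₊ with hK
  have hex : ∃ k ≤ K, trustTest f a p sol x0 k := by
    by_contra hcon
    push Not at hcon
    -- If iterations `0, …, K` all failed, the total decrease would be `(K + 1) * (μ * κ ^ 2 / 2000)
    -- > Δ`, exceeding the initial suboptimality.
    have htel : ∀ k ≤ K + 1, barrier f a μ (trustIterate a p sol x0 k) ≤
        barrier f a μ x0 - k * (μ * κ ^ 2 / 2000) := by
      intro k hk
      induction k with
      | zero => simp [trustIterate]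
      | succ k ih =>
        have e1 := ih (by omega)
        have e2 := hdec k (hcon k (by omega))
        push_cast
        linarith
    have e1 := htel (K + 1) le_rfl
    have e2 := hΔ _ (hmem (K + 1))
    have e3 := Nat.lt_floor_add_one (2000 * (Δ / (μ * κ ^ 2)))
    rw [← hK, ← mul_div_assoc, div_lt_iff₀ hc] at e3
    push_cast at e1
    linarith
  classical
  have hex' : ∃ k, trustTest f a p sol x0 k := hex.imp fun _ h => h.2
  obtain ⟨k0, hk0, ht0⟩ := hex
  have hle : Nat.find hex' ≤ K := (Nat.find_min' hex' ht0).trans hk0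
  have hΔ0 : 0 ≤ Δ := by simpa using hΔ x0 hx0
  refine ⟨Nat.find hex' + 1, _, _, ⟨Nat.find hex', rfl, fun l hl => Nat.find_min hex' hl,
    Nat.find_spec hex', rfl, rfl⟩, ?_, (Nat.find_spec hex').1, fun i => ?_, fun i => ?_⟩
  · have e1 : (Nat.find hex' : ℝ) ≤ K := by exact_mod_cast hle
    have e2 : (K : ℝ) ≤ 2000 * (Δ / (μ * κ ^ 2)) := Nat.floor_le (by positivity)
    push_cast
    linarith
  · rw [hprim, hdual]
    exact P.stepDual_mul_le (hsc _ (hmem _)) (hstep _) i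
  · rw [hprim, hdual]
    refine le_trans ?_ (P.le_stepDual_mul (hsc _ (hmem _)) (hstep _) i)
    have : κ * μ ≤ 1 * μ := mul_le_mul_of_nonneg_right (hsc _ hx0).kappa_le hμ.le
    linarith

/-! ### Approximate optimality of Fritz John points -/

/-- Gradient inequalities for `f` and the constraints bound the change of the Lagrangian from `x` to
`z` by its gradient, whose pairing with `z - x` is at most `τl * μ * √ζ * R = m * μ`. -/
lemma obj_sub_le_of_FJ1 (P : SmoothConvex f a L1 L2) {τc R ζ : ℝ} {y : Fin m → ℝ} (hR : 0 < R)
    (hζ : 0 < ζ) (hμ : 0 < μ) (hF : FJ1 f a μ (tauL m R ζ) τc x y) (hy : l1 y + 1 ≤ ζ)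
    {z : E n} (hz : z ∈ feasible a) (hxz : ‖x - z‖ ≤ R) :
    f x - f z ≤ m * μ + ∑ i, (y i * a i x - y i * a i z) := by
  have hx : x ∈ feasible a := hF.primal_pos
  have h1 := P.obj_grad hx hz
  have h2 : ∑ i, y i * (a i z - a i x) ≤ ∑ i, y i * fderiv ℝ (a i) x (z - x) :=
    Finset.sum_le_sum fun i _ => mul_le_mul_of_nonneg_left
      (by linarith [P.con_grad i hx hz]) (hF.dual_pos i).le
  have h3 : -(m * μ) ≤ (fderiv ℝ f x - ∑ i, y i • fderiv ℝ (a i) x) (z - x) := by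
    refine neg_le_of_abs_le ?_
    have e1 := hF.grad_lag
    rw [P.norm_gradient_lagrangian hx] at e1
    have e2 : tauL m R ζ * μ * Real.sqrt (l1 y + 1) ≤ tauL m R ζ * μ * Real.sqrt ζ := by
      unfold tauL
      gcongr
    have e3 : tauL m R ζ * μ * Real.sqrt ζ * R = m * μ := by
      have := (Real.sqrt_pos.2 hζ).ne'
      unfold tauL
      field_simp
    rw [norm_sub_rev] at hxz
    calc _ ≤ _ := ContinuousLinearMap.le_of_opNorm_le_of_le _ (e1.trans e2) hxz
      _ = _ := e3
  have h4 : (fderiv ℝ f x - ∑ i, y i • fderiv ℝ (a i) x) (z - x) =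
      fderiv ℝ f x (z - x) - ∑ i, y i * fderiv ℝ (a i) x (z - x) := by
    simp only [_root_.sub_apply, _root_.sum_apply, _root_.smul_apply, smul_eq_mul]
  have h5 : ∑ i, (y i * a i x - y i * a i z) = -∑ i, y i * (a i z - a i x) := by
    rw [← Finset.sum_neg_distrib]
    exact Finset.sum_congr rfl fun i _ => by ring
  linarith

lemma obj_sub_le_two_mul (P : SmoothConvex f a L1 L2) {τc R ζ : ℝ} {y : Fin m → ℝ} (hR : 0 < R)
    (hζ : 0 < ζ) (hμ : 0 < μ) (hF : FJ1 f a μ (tauL m R ζ) τc x y) (hy : l1 y + 1 ≤ ζ)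
    (hc : ∀ i, y i * a i x ≤ μ) {z : E n} (hz : z ∈ feasible a) (hxz : ‖x - z‖ ≤ R) :
    f x - f z ≤ 2 * m * μ := by
  have h1 := P.obj_sub_le_of_FJ1 hR hζ hμ hF hy hz hxz
  have h2 : ∑ i, (y i * a i x - y i * a i z) ≤ ∑ _i : Fin m, μ :=
    Finset.sum_le_sum fun i _ => by linarith [hc i, mul_pos (hF.dual_pos i) (hz i)]
  simp only [Finset.sum_const, Finset.card_univ, Fintype.card_fin, nsmul_eq_mul] at h2
  linarith

/-- The warm start. With `c = y i * a i x` and `t = a i z / a i x`, each constraint contributes `c -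
c * t + μ / 2 * log t ≤ c - μ / 2 ≤ μ`, using `log t ≤ t - 1` and `c ≥ μ / 2`. The lower bound on
`c` thus matches the halving of `μ`. -/
lemma barrier_half_sub_le (P : SmoothConvex f a L1 L2) {τc R ζ : ℝ} {y : Fin m → ℝ} (hR : 0 < R)
    (hζ : 0 < ζ) (hμ : 0 < μ) (hF : FJ1 f a μ (tauL m R ζ) τc x y) (hy : l1 y + 1 ≤ ζ)
    (hc : ∀ i, y i * a i x ≤ μ) (hc' : ∀ i, μ / 2 ≤ y i * a i x) {z : E n}
    (hz : z ∈ feasible a) (hxz : ‖x - z‖ ≤ R) :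
    barrier f a (μ / 2) x - barrier f a (μ / 2) z ≤ 2 * m * μ := by
  have hx : x ∈ feasible a := hF.primal_pos
  have h1 := P.obj_sub_le_of_FJ1 hR hζ hμ hF hy hz hxz
  have h2 : ∑ i, (y i * a i x - y i * a i z) +
      μ / 2 * ∑ i, (Real.log (a i z) - Real.log (a i x)) ≤ ∑ _i : Fin m, μ := by
    rw [Finset.mul_sum, ← Finset.sum_add_distrib]
    refine Finset.sum_le_sum fun i _ => ?_
    rw [← Real.log_div (hz i).ne' (hx i).ne']
    have e1 := Real.log_le_sub_one_of_pos (div_pos (hz i) (hx i))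
    have e2 : y i * a i z = y i * a i x * (a i z / a i x) := by
      have := (hx i).ne'
      field_simp
    have e3 : μ / 2 * (a i z / a i x) ≤ y i * a i x * (a i z / a i x) :=
      mul_le_mul_of_nonneg_right (hc' i) (div_pos (hz i) (hx i)).le
    have e4 := mul_le_mul_of_nonneg_left e1 (half_pos hμ).le
    linarith [hc i]
  simp only [Finset.sum_const, Finset.card_univ, Fintype.card_fin, nsmul_eq_mul,
    Finset.sum_sub_distrib, mul_sub] at h1 h2
  unfold barrier
  linarith

end SmoothConvex

/-! ### Annealing -/

/-- Dependent choice along an invariant. -/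
lemma exists_seq_of_invariant {α β : Type*} {inv : ℕ → α → Prop} {R : ℕ → α → α → β → Prop}
    {x0 : α} (h0 : inv 0 x0) (hs : ∀ j x, inv j x → ∃ x' b, R j x x' b ∧ inv (j + 1) x') :
    ∃ (xs : ℕ → α) (bs : ℕ → β), xs 0 = x0 ∧ ∀ j, R j (xs j) (xs (j + 1)) (bs j) := by
  choose F B hR hI using hs
  let s : (j : ℕ) → {x // inv j x} := fun j =>
    Nat.rec ⟨x0, h0⟩ (fun j p => ⟨F j p.1 p.2, hI j p.1 p.2⟩) j
  exact ⟨fun j => (s j).1, fun j => B j (s j).1 (s j).2, rfl, fun j => hR j (s j).1 (s j).2⟩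

/-! ### Arithmetic of the parameters and the cost of one warm-started call. -/

lemma tauL_pos {R ζ : ℝ} (hm : 1 ≤ m) (hR : 0 < R) (hζ : 0 < ζ) : 0 < tauL m R ζ := by
  have : 0 < (m : ℝ) := by exact_mod_cast hm
  unfold tauL
  positivity

lemma muInit_pos {L1 L2 R ζ : ℝ} (hm : 1 ≤ m) (hL1 : 0 < L1) (hL2 : 0 < L2) (hR : 0 < R)
    (hζ : 0 < ζ) : 0 < muInit m L1 L2 R ζ := by
  have : 0 < (m : ℝ) := by exact_mod_cast hm
  unfold muInit
  exact lt_min (by positivity) (by positivity)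

lemma tauL_sq {R ζ : ℝ} (hζ : 0 < ζ) : tauL m R ζ ^ 2 = m ^ 2 / (R ^ 2 * ζ) := by
  rw [tauL, div_pow, mul_pow, Real.sq_sqrt hζ.le]

lemma tauL_sq_mul_le {L1 L2 R ζ μ : ℝ} (hm : 1 ≤ m) (hR : 0 < R)
    (hζ : 0 < ζ) (hμ : μ ≤ muInit m L1 L2 R ζ) : tauL m R ζ ^ 2 * μ ≤ L1 := by
  have hm' : 0 < (m : ℝ) := by exact_mod_cast hm
  have h := hμ.trans (min_le_left _ _)
  rw [le_div_iff₀ (by positivity)] at h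
  rw [tauL_sq hζ, div_mul_eq_mul_div, div_le_iff₀ (by positivity)]
  linarith

lemma cube_mul_le {L1 L2 R ζ μ : ℝ} (hL2 : 0 < L2) (hR : 0 < R)
    (hζ : 0 < ζ) (hμ : μ ≤ muInit m L1 L2 R ζ) : L2 ^ 3 * μ ≤ L1 ^ 4 * tauL m R ζ := by
  have h := hμ.trans (min_le_right _ _)
  have hs := Real.sqrt_pos.2 hζ
  rw [le_div_iff₀ (by positivity)] at h
  rw [tauL, ← mul_div_assoc, le_div_iff₀ (by positivity)]
  linarith

lemma inv_tauC_sq {L1 R ζ μ : ℝ} (hL1 : 0 < L1) (hζ : 0 < ζ) (hμ : 0 < μ) :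
    (tauC L1 (tauL m R ζ) μ ^ 2)⁻¹ = (L1 * R ^ 2 * ζ / (m ^ 2 * μ)) ^ (2 / 3 : ℝ) := by
  have h1 : tauL m R ζ ^ 2 * μ / L1 = (L1 * R ^ 2 * ζ / (m ^ 2 * μ))⁻¹ := by
    rw [tauL_sq hζ, inv_div]
    ring
  rw [tauC, ← Real.rpow_natCast, ← Real.rpow_mul (by positivity), h1,
    Real.inv_rpow (by positivity), inv_inv]
  norm_num

/-- Before termination `m * μ` is at least of order `ε`. Substituting this removes one factor `m`
inside the power `2 / 3`, and `m * m ^ (-2 / 3) = m ^ (1 / 3)`. -/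
lemma card_mul_inv_tauC_sq_le {L1 R ζ μ ε : ℝ} (hm : 1 ≤ m) (hL1 : 0 < L1)
    (hζ : 0 < ζ) (hμ : 0 < μ) (hε : 0 < ε) (h : ε ≤ 4 * μ * m) :
    m * (tauC L1 (tauL m R ζ) μ ^ 2)⁻¹ ≤
      4 * ((m : ℝ) ^ (1 / 3 : ℝ) * (L1 * R ^ 2 * ζ / ε) ^ (2 / 3 : ℝ)) := by
  have hm' : 0 < (m : ℝ) := by exact_mod_cast hm
  rw [inv_tauC_sq hL1 hζ hμ]
  have h1 : L1 * R ^ 2 * ζ / (m ^ 2 * μ) ≤ 4 / m * (L1 * R ^ 2 * ζ / ε) := by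
    rw [div_mul_div_comm]
    rw [div_le_div_iff₀ (by positivity) (by positivity)]
    have : 0 ≤ L1 * R ^ 2 * ζ * m := by positivity
    nlinarith [mul_le_mul_of_nonneg_left h this]
  have h2 : (4 : ℝ) ^ (2 / 3 : ℝ) ≤ 4 := by
    conv_rhs => rw [← Real.rpow_one 4]
    exact Real.rpow_le_rpow_of_exponent_le (by norm_num) (by norm_num)
  have h3 : (m : ℝ) * (m : ℝ)⁻¹ ^ (2 / 3 : ℝ) = (m : ℝ) ^ (1 / 3 : ℝ) := by
    rw [Real.inv_rpow hm'.le, ← Real.rpow_neg hm'.le]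
    conv_lhs => rw [← Real.rpow_one (m : ℝ), ← Real.rpow_mul hm'.le, ← Real.rpow_add hm']
    norm_num
  have h4 : 0 ≤ (L1 * R ^ 2 * ζ / ε) ^ (2 / 3 : ℝ) := by positivity
  calc (m : ℝ) * (L1 * R ^ 2 * ζ / (m ^ 2 * μ)) ^ (2 / 3 : ℝ)
      ≤ m * (4 / m * (L1 * R ^ 2 * ζ / ε)) ^ (2 / 3 : ℝ) := by gcongr
    _ = (4 : ℝ) ^ (2 / 3 : ℝ) *
        ((m * (m : ℝ)⁻¹ ^ (2 / 3 : ℝ)) * (L1 * R ^ 2 * ζ / ε) ^ (2 / 3 : ℝ)) := by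
      rw [div_eq_mul_inv 4 (m : ℝ), Real.mul_rpow (by positivity) (by positivity),
        Real.mul_rpow (by positivity) (by positivity)]
      ring
    _ ≤ _ := by rw [h3]; gcongr

lemma logPlus_ge_one (t : ℝ) : 1 ≤ logPlus t := le_max_right _ _

/-- The number of halvings of the barrier parameter. -/
lemma natCast_le_mul_logPlus {k : ℕ} {t : ℝ} (ht : 0 < t) (h : (2 : ℝ) ^ k ≤ 4 * t) :
    (k : ℝ) ≤ 5 * logPlus t := by
  have h1 := Real.log_le_log (by positivity) h
  rw [Real.log_pow, Real.log_mul (by norm_num) ht.ne',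
    show (4 : ℝ) = 2 ^ 2 by norm_num, Real.log_pow] at h1
  have h2 := Real.log_two_gt_d9
  have h3 := Real.log_two_lt_d9
  have h4 : Real.log t ≤ logPlus t := le_max_left _ _
  have h5 := logPlus_ge_one t
  push_cast at h1
  have h6 : (k : ℝ) * 0.69 ≤ k * Real.log 2 := by gcongr; linarith
  norm_num at h6
  linarith

/-! ### Finiteness of the infima on a bounded feasible set. -/

section Bounded

variable {f : E n → ℝ} {a : Fin m → E n → ℝ} {R : ℝ} {x0 : E n}

lemma feasible_subset_closedBall (hdiam : ∀ x ∈ feasible a, ∀ z ∈ feasible a, ‖x - z‖ ≤ R)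
    (hx0 : x0 ∈ feasible a) : feasible a ⊆ Metric.closedBall x0 R := fun x hx => by
  rw [mem_closedBall_iff_norm]
  exact hdiam x hx x0 hx0

lemma bddBelow_obj (hf : Continuous f)
    (hdiam : ∀ x ∈ feasible a, ∀ z ∈ feasible a, ‖x - z‖ ≤ R) (hx0 : x0 ∈ feasible a) :
    BddBelow (f '' feasible a) :=
  ((isCompact_closedBall x0 R).bddBelow_image hf.continuousOn).mono
    (image_mono (feasible_subset_closedBall hdiam hx0))

lemma bddBelow_barrier (hf : Continuous f) (ha : ∀ i, Continuous (a i))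
    (hdiam : ∀ x ∈ feasible a, ∀ z ∈ feasible a, ‖x - z‖ ≤ R) (hx0 : x0 ∈ feasible a)
    {μ : ℝ} (hμ : 0 ≤ μ) : BddBelow (barrier f a μ '' feasible a) := by
  -- The barrier is unbounded near the boundary; since `log t ≤ t`, this continuous function lies
  -- below it and is bounded below on a compact ball.
  have hc : Continuous fun x => f x - μ * ∑ i, a i x := by fun_prop
  obtain ⟨b, hb⟩ := (isCompact_closedBall x0 R).bddBelow_image hc.continuousOn
  refine ⟨b, ?_⟩
  rintro _ ⟨x, hx, rfl⟩
  refine (hb ⟨x, feasible_subset_closedBall hdiam hx0 hx, rfl⟩).trans ?_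
  have : ∑ i, Real.log (a i x) ≤ ∑ i, a i x := Finset.sum_le_sum fun i _ =>
    (Real.log_le_sub_one_of_pos (hx i)).trans (by linarith)
  exact sub_le_sub_left (mul_le_mul_of_nonneg_left this hμ) (f x)

end Bounded

end IPM

/-! ### The complexity bound for Annealed-IPM. -/

theorem theorem2 :
    -- an absolute constant, the one hidden in the `𝒪`
    ∃ C : ℝ, 0 < C ∧
      ∀ (n m : ℕ) (_ : 1 ≤ m) (f : IPM.E n → ℝ) (a : Fin m → IPM.E n → ℝ)
        (L1 L2 R ζ ε : ℝ) (x0 : IPM.E n),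
        0 < L1 → 0 < L2 → 0 < R → 1 < ζ → 0 < ε →
        -- Lipschitz first and second derivatives on the strictly feasible set
        (∀ i, Continuous (a i)) →
        IPM.LipschitzDeriv 1 L1 f (IPM.feasible a) →
        IPM.LipschitzDeriv 2 L2 f (IPM.feasible a) →
        (∀ i, IPM.LipschitzDeriv 1 L1 (a i) (IPM.feasible a)) →
        (∀ i, IPM.LipschitzDeriv 2 L2 (a i) (IPM.feasible a)) →
        -- convexity
        ConvexOn ℝ Set.univ f →
        (∀ i, ConcaveOn ℝ Set.univ (a i)) →
        -- the starting point is strictly feasible, and the feasible set has diameter at most `R`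
        x0 ∈ IPM.feasible a →
        (∀ x ∈ IPM.feasible a, ∀ z ∈ IPM.feasible a, ‖x - z‖ ≤ R) →
        -- regularity: dual variables of approximate Fritz John points are bounded by `ζ`, for
        -- the barrier parameters `μ_j` of the algorithm
        (∀ (j : ℕ) (x : IPM.E n) (y : Fin m → ℝ),
          IPM.FJ1 f a (IPM.muInit m L1 L2 R ζ / 2 ^ j) (IPM.tauL m R ζ)
            (IPM.tauC L1 (IPM.tauL m R ζ) (IPM.muInit m L1 L2 R ζ / 2 ^ j)) x y →
          IPM.l1 y + 1 ≤ ζ) →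
        -- both infima below are finite, and trust region subproblems can be solved
        BddBelow (f '' IPM.feasible a) ∧
        BddBelow (IPM.barrier f a (IPM.muInit m L1 L2 R ζ) '' IPM.feasible a) ∧
        (∃ sol : IPM.Solver n, IPM.IsSolver f a sol) ∧
        -- whatever minimizers are used, the algorithm returns an `ε`-optimal point after at
        -- most the claimed number of trust region subproblem solves
        ∀ sol : IPM.Solver n, IPM.IsSolver f a sol →
          ∃ (N : ℕ) (x : IPM.E n),
            IPM.AnnealedIPMReturns (IPM.convexGen f a L1 (IPM.tauL m R ζ) sol)
              (IPM.muInit m L1 L2 R ζ) x0 ε N x ∧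
            x ∈ IPM.feasible a ∧
            f x - IPM.optValue f a ≤ ε ∧
            (N : ℝ) ≤ C *
              (((m : ℝ) ^ (1 / 3 : ℝ) * (L1 * R ^ 2 * ζ / ε) ^ (2 / 3 : ℝ) + 1) *
                  IPM.logPlus (m * IPM.muInit m L1 L2 R ζ / ε) +
                (IPM.barrier f a (IPM.muInit m L1 L2 R ζ) x0 -
                    IPM.barrierInf f a (IPM.muInit m L1 L2 R ζ)) /
                  IPM.muInit m L1 L2 R ζ *
                  (L1 * R ^ 2 * ζ / (m ^ 2 * IPM.muInit m L1 L2 R ζ)) ^ (2 / 3 : ℝ)) := by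
  refine ⟨200000, by norm_num, ?_⟩
  intro n m hm f a L1 L2 R ζ ε x0 hL1 hL2 hR hζ1 hε hac hf1 hf2 ha1 ha2 hfc hacc hx0 hdiam hreg
  have hζ : 0 < ζ := by linarith
  have hm' : 0 < (m : ℝ) := by exact_mod_cast hm
  have hXo := IPM.isOpen_feasible hac
  have hX := IPM.convex_feasible hacc
  have P : IPM.SmoothConvex f a L1 L2 :=
    ⟨hL1, hL2, hac, hXo, hX, IPM.smoothOn_of_lipschitzDeriv hXo hX hf1 hf2 hL1.le hL2,
      fun i => IPM.smoothOn_of_lipschitzDeriv hXo hX (ha1 i) (ha2 i) hL1.le hL2, hfc, hacc⟩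
  have hfcont : Continuous f := continuousOn_univ.1 (hfc.continuousOn isOpen_univ)
  have hμ0 := IPM.muInit_pos (m := m) hm hL1 hL2 hR hζ
  have hτ := IPM.tauL_pos (m := m) hm hR hζ
  have hbdd := IPM.bddBelow_obj hfcont hdiam hx0
  have hbddψ := IPM.bddBelow_barrier hfcont hac hdiam hx0 hμ0.le
  refine ⟨hbdd, hbddψ, IPM.SmoothConvex.exists_isSolver f a, fun sol hsol => ?_⟩
  set μ0 := IPM.muInit m L1 L2 R ζ with hμ0def
  set τl := IPM.tauL m R ζ with hτdef
  set Δ0 := IPM.barrier f a μ0 x0 - IPM.barrierInf f a μ0 with hΔ0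
  have hμj : ∀ j : ℕ, 0 < μ0 / 2 ^ j := fun j => by positivity
  have hμle : ∀ j : ℕ, μ0 / 2 ^ j ≤ μ0 := fun j =>
    div_le_self hμ0.le (one_le_pow₀ one_le_two)
  -- Suboptimality bound at the start of call `j`: for `j ≥ 1` it is `2 * m` times the previous
  -- barrier parameter, which is twice the current one.
  let Δ : ℕ → ℝ := fun j => if j = 0 then Δ0 else 4 * m * (μ0 / 2 ^ j)
  have hΔ0nn : 0 ≤ Δ0 := sub_nonneg.2 (csInf_le hbddψ ⟨x0, hx0, rfl⟩)
  -- The calls are continued forever, regardless of the stopping rule; the run is cut at the first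
  -- `k` satisfying it.
  obtain ⟨xs, bs, hxs0, hxs⟩ := IPM.exists_seq_of_invariant (x0 := x0)
    (inv := fun j x => x ∈ IPM.feasible a ∧ ∀ z ∈ IPM.feasible a,
      IPM.barrier f a (μ0 / 2 ^ j) x - IPM.barrier f a (μ0 / 2 ^ j) z ≤ Δ j)
    (R := fun j x x' (b : ℕ × (Fin m → ℝ)) =>
      IPM.convexGen f a L1 τl sol j (μ0 / 2 ^ j) x b.1 x' b.2 ∧
      x' ∈ IPM.feasible a ∧
      (b.1 : ℝ) ≤ 1 + 2000 * (Δ j / (μ0 / 2 ^ j * IPM.tauC L1 τl (μ0 / 2 ^ j) ^ 2)) ∧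
      ∀ z ∈ IPM.feasible a, f x' - f z ≤ 2 * m * (μ0 / 2 ^ j))
    (by
      refine ⟨hx0, fun z hz => ?_⟩
      simp only [Δ, if_true, pow_zero, div_one, hΔ0]
      have : IPM.barrierInf f a μ0 ≤ IPM.barrier f a μ0 z := csInf_le hbddψ ⟨z, hz, rfl⟩
      linarith)
    (by
      rintro j x ⟨hx, hΔx⟩
      obtain ⟨N, x', y', hret, hN, hFJ, hc, hc'⟩ := P.exists_trustIPMReturns hτ (hμj j)
        (IPM.tauL_sq_mul_le hm hR hζ (hμle j)) (IPM.cube_mul_le hL2 hR hζ (hμle j)) hx hΔx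
        (sol := fun k => sol j k (μ0 / 2 ^ j))
        (fun k x hx r hr => hsol j k _ x r (hμj j) hx hr)
      have hx' : x' ∈ IPM.feasible a := hFJ.primal_pos
      have hy := hreg j x' y' hFJ
      refine ⟨x', (N, y'), ⟨hret, hx', hN, fun z hz =>
        P.obj_sub_le_two_mul hR hζ (hμj j) hFJ hy hc hz (hdiam _ hx' _ hz)⟩, hx',
        fun z hz => ?_⟩
      have := P.barrier_half_sub_le hR hζ (hμj j) hFJ hy hc hc' hz (hdiam _ hx' _ hz)
      have e : μ0 / 2 ^ (j + 1) = μ0 / 2 ^ j / 2 := by rw [pow_succ, div_mul_eq_div_div]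
      simp only [Δ, e, Nat.succ_ne_zero, if_false]
      linarith)
  have hex : ∃ k : ℕ, 2 * (μ0 / 2 ^ k) * m ≤ ε := by
    obtain ⟨k, hk⟩ := pow_unbounded_of_one_lt (2 * μ0 * m / ε) one_lt_two
    refine ⟨k, ?_⟩
    rw [div_lt_iff₀ hε] at hk
    rw [← mul_div_assoc, div_mul_eq_mul_div, div_le_iff₀ (by positivity)]
    linarith
  classical
  set k := Nat.find hex with hk
  have hkmin : ∀ j < k, ε < 2 * (μ0 / 2 ^ j) * m := fun j hj => not_le.1 (Nat.find_min hex hj)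
  have hkspec : 2 * (μ0 / 2 ^ k) * m ≤ ε := Nat.find_spec hex
  -- Call `j` returns the dual vector indexed `j + 1`, hence the shift `j - 1`.
  refine ⟨∑ j ∈ Finset.range (k + 1), (bs j).1, xs (k + 1),
    ⟨k, xs, fun j => (bs (j - 1)).2, fun j => (bs j).1, hxs0, fun j _ => (hxs j).1, hkmin, hkspec,
      rfl, rfl⟩, (hxs k).2.1, ?_, ?_⟩
  · have : f (xs (k + 1)) - ε ≤ IPM.optValue f a := by
      refine le_csInf ⟨_, x0, hx0, rfl⟩ ?_
      rintro _ ⟨z, hz, rfl⟩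
      have := (hxs k).2.2.2 z hz
      linarith
    linarith
  · set G := (m : ℝ) ^ (1 / 3 : ℝ) * (L1 * R ^ 2 * ζ / ε) ^ (2 / 3 : ℝ) with hG
    set T := Δ0 / μ0 * (L1 * R ^ 2 * ζ / (m ^ 2 * μ0)) ^ (2 / 3 : ℝ) with hT
    set ℓ := IPM.logPlus (m * μ0 / ε) with hℓ
    have hG0 : 0 ≤ G := by positivity
    have hT0 : 0 ≤ T := by positivity
    have hℓ1 : 1 ≤ ℓ := IPM.logPlus_ge_one _
    have hfirst : ((bs 0).1 : ℝ) ≤ 1 + 2000 * T := by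
      refine (hxs 0).2.2.1.trans (le_of_eq ?_)
      simp only [Δ, if_true, pow_zero, div_one]
      rw [hT, ← IPM.inv_tauC_sq hL1 hζ hμ0, div_mul_eq_div_div, div_eq_mul_inv (Δ0 / μ0)]
    -- `32000 = 2000 * 4 * 4`: the iteration constant, the `4` in `Δ`, and the `4` of
    -- `card_mul_inv_tauC_sq_le`. That lemma applies because call `j` had not yet met the stopping
    -- rule.
    have hrest : ∀ j ∈ Finset.range k, ((bs (j + 1)).1 : ℝ) ≤ 1 + 32000 * G := by
      intro j hj
      have hjk := Finset.mem_range.1 hj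
      refine (hxs (j + 1)).2.2.1.trans ?_
      have hεj : ε ≤ 4 * (μ0 / 2 ^ (j + 1)) * m := by
        have := (hkmin j hjk).le
        rw [pow_succ, div_mul_eq_div_div]
        linarith
      have h1 := IPM.card_mul_inv_tauC_sq_le (R := R) hm hL1 hζ (hμj (j + 1)) hε hεj
      have h2 : Δ (j + 1) / (μ0 / 2 ^ (j + 1) * IPM.tauC L1 τl (μ0 / 2 ^ (j + 1)) ^ 2) =
          4 * (m * (IPM.tauC L1 τl (μ0 / 2 ^ (j + 1)) ^ 2)⁻¹) := by
        have h3 := (hμj (j + 1)).ne'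
        simp only [Δ, Nat.succ_ne_zero, if_false]
        rw [div_mul_eq_div_div, mul_div_assoc, div_self h3]
        ring
      rw [h2]
      linarith
    have hkℓ : (k : ℝ) ≤ 5 * ℓ := by
      rcases Nat.eq_zero_or_pos k with h0 | hpos
      · rw [h0, Nat.cast_zero]
        linarith
      · refine IPM.natCast_le_mul_logPlus (by positivity) ?_
        have h1 := hkmin (k - 1) (by omega)
        have h2 : (2 : ℝ) ^ k = 2 ^ (k - 1) * 2 := by rw [← pow_succ, Nat.sub_add_cancel hpos]
        rw [← mul_div_assoc, div_mul_eq_mul_div, lt_div_iff₀ (by positivity)] at h1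
        rw [h2, ← mul_div_assoc, le_div_iff₀ hε]
        linarith
    rw [Finset.sum_range_succ', Nat.cast_add, Nat.cast_sum]
    have hsum := Finset.sum_le_sum hrest
    rw [Finset.sum_const, Finset.card_range, nsmul_eq_mul] at hsum
    -- The total is at most `1 + 2000 * T + 5 * ℓ + 160000 * G * ℓ`, and `ℓ ≥ 1` absorbs the
    -- constant term.
    have h1 : (k : ℝ) * (1 + 32000 * G) ≤ 5 * ℓ * (1 + 32000 * G) := by gcongr
    have h2 : 0 ≤ G * ℓ := by positivity
    linarith
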